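/- Let $S,A$ be finite nonempty sets and consider an MDP with initial state distribution $p$, transition probabilities $P(s'\mid s,a)$, reward function $r:S\times A\to[0,1]$ and discount factor $\gamma\in[0,1)$. For a policy $\pi(a\mid s)$ let $V^\pi(s)=(1-\gamma)\,\mathbb E\big[\sum_{t\ge 0}\gamma^t r(s_t,a_t)\mid s_0=s\big]$ and $V^\pi(p)=\mathbb E_{s\sim p}[V^\pi(s)]$. Let $\pi^*$ be an optimal policy (a maximizer of $V^\pi(p)$), $V^*(p)=V^{\pi^*}(p)$, and $\mu^*(s,a)=(1-\gamma)\sum_{t\ge0}\gamma^t\Pr_{\pi^*}(s_t=s)\,\pi^*(a\mid s)$ with $s_0\sim p$. The MDP is accessed only through a generative model, which on request returns a sample $s_0\sim p$, or, for a chosen pair $(s,a)$, the reward $r(s,a)$ together with a sample $s'\sim P(\cdot\mid s,a)$; each request counts as one sample. For $v\in\mathbb R^{S}$, $\mu\in\mathbb R^{S\times A}$ put $$a_v(s,a)=r(s,a)+\tfrac1{1-\gamma}\Big(\gamma\sum_{s'}P(s'\mid s,a)v(s')-v(s)\Big),\qquad L(v,\mu)=p^\top v+\mu^\top a_v,$$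 and for $x=(v,\mu)$, $x'=(v',\mu')$ put $F(x,x')=L(v',\mu)-L(v,\mu')$ and $r_{ep}(x;x')=F(x,x)-F(x,x')$. Let $d_v,d_\mu\ge1$, let $\Phi\in\mathbb R^{S\times d_v}$ have columns of sup-norm at most $1$ (in particular, columns in $[0,1]^S$ are allowed), let $\Psi\in\mathbb R^{(S\times A)\times d_\mu}$ have columns that are probability distributions on $S\times A$, let $C_v>0$, and let $$\Theta=\Big\{\theta=(\theta_v,\theta_\mu)\in\mathbb R^{d_v}\times\mathbb R^{d_\mu}:\ \|\theta_v\|_2\le \tfrac{C_v}{\sqrt{d_v}},\ \theta_\mu\ge0,\ \|\theta_\mu\|_1=1\Big\},\qquad \dim(\Theta):=d_v+d_\mu,$$ $x_\theta=(v_\theta,\mu_\theta)=(\Phi\theta_v,\Psi\theta_\mu)$. Mirror descent with $N\ge1$ rounds: start at $\theta_1\in\Theta$ with $\theta_{\mu,1}$ uniform and $\theta_{v,1}$ arbitrary. For $n=1,\dots,N-1$: draw $s_0\sim p$, $(s,a)\sim\Psi\theta_{\mu,n}$, $s'\sim P(\cdot\mid s,a)$; independently draw an index $k$ uniformly from $\{1,\dots,d_\mu\}$,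 a pair $(\hat s,\hat a)$ from the $k$-th column of $\Psi$, and query its reward and a next state $\hat s'\sim P(\cdot\mid\hat s,\hat a)$; let $g_n=(g_{n,v},g_{n,\mu})$ with $$g_{n,v}=\Phi(s_0,\cdot)+\tfrac{1}{1-\gamma}\big(\gamma\Phi(s',\cdot)-\Phi(s,\cdot)\big),\qquad g_{n,\mu}=d_\mu\Big(\tfrac1{1-\gamma}-r(\hat s,\hat a)-\tfrac{\gamma v_{\theta_n}(\hat s')-v_{\theta_n}(\hat s)}{1-\gamma}\Big)e_k,$$ and update $$\theta_{n+1}=\operatorname*{argmin}_{\theta\in\Theta}\ \langle g_n,\theta\rangle+\tfrac1\eta\Big(\tfrac{d_v}{2C_v^2}\|\theta_v-\theta_{v,n}\|_2^2+\mathrm{KL}(\theta_\mu\|\theta_{\mu,n})\Big),\qquad \eta=\frac{1-\gamma}{\sqrt{N(C_v^2+d_\mu)}} .$$ Output $\hat x_N=(\hat v_N,\hat\mu_N)=\frac1N\sum_{n=1}^N x_{\theta_n}$ and a policy $\hat\pi_N(a\mid s)\propto\hat\mu_N(s,a)$ (arbitrary at states of zero $\hat\mu_N$-mass). The approximation error is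 $$\epsilon_{\Theta,N}=\min_{\theta\in\Theta}\Big(r_{ep}\big(\hat x_N;(V^{\hat\pi_N},\mu^*)\big)-r_{ep}(\hat x_N;x_\theta)\Big).$$ Theorem. For every $C_v>0$ there is a constant $C>0$, depending only on $C_v$, such that for all $d_v,d_\mu\ge1$, $\gamma\in[0,1)$, $\epsilon>0$ and $\delta\in(0,1)$ there is a number of rounds $N_0\ge1$, the same for all finite nonempty $S,A$, all such $\Phi,\Psi$, all such $\theta_1$ and all MDPs on $S,A$, for which the following holds. With $N_0$ rounds the algorithm always uses at most $$C\,\frac{\dim(\Theta)\,(1+\log\dim(\Theta))^2\,\log(2/\delta)}{(1-\gamma)^2\epsilon^2}$$ samples, that is, $\tilde O\big(\frac{\dim(\Theta)\log(1/\delta)}{(1-\gamma)^2\epsilon^2}\big)$, independent of $|S|$ and $|A|$; and for every $N\ge N_0$ and every optimal policy $\pi^*$, with probability at least $1-\delta$ the output policy is $(\epsilon+\epsilon_{\Theta,N})$-optimal, i.e. $V^*(p)-V^{\hat\pi_N}(p)\le\epsilon+\epsilon_{\Theta,N}$ (for every choice of $\hat\pi_N$ at states of zero $\hat\mu_N$-mass).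 -/

import Mathlib

universe u v w

noncomputable section

namespace MirrorRL

/-! ### Discounted Markov decision processes -/

/-- A finite Markov decision process without its discount factor: initial state distribution `p`,
transition probabilities `P(· | s, a)` and reward function `r : S × A → [0, 1]`. -/
structure MDP (S : Type u) (A : Type v) where
  init : PMF S
  trans : S → A → PMF S
  reward : S → A → ℝ
  reward_mem : ∀ s a, reward s a ∈ Set.Icc (0 : ℝ) 1

/-- A (stationary, randomized) policy `π(a | s)`. -/
abbrev Policy (S : Type u) (A : Type v) := S → PMF A

/-- A pair `x = (v, μ)` of a function on states and a function on state-action pairs. -/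
abbrev Decision (S : Type u) (A : Type v) := (S → ℝ) × (S × A → ℝ)

namespace MDP

variable {S : Type u} {A : Type v}

/-- The law of the state at time `t` when `π` is run and the state at time `0` has law `ν`. -/
def stateLaw (M : MDP S A) (π : Policy S A) (ν : PMF S) : ℕ → PMF S
  | 0 => ν
  | t + 1 => (stateLaw M π ν t).bind fun s => (π s).bind fun a => M.trans s a

variable [Fintype S] [Fintype A]

/-- The expected reward `E[r(s_t, a_t)]` at time `t` along the trajectory of `π` started at `s`. -/
def expReward (M : MDP S A) (π : Policy S A) (s : S) (t : ℕ) : ℝ :=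
  ∑ s', (M.stateLaw π (PMF.pure s) t s').toReal * ∑ a, (π s' a).toReal * M.reward s' a

/-- The normalized value function `V^π(s) = (1 - γ) E[∑_t γ^t r(s_t, a_t) | s_0 = s]`. -/
def value (M : MDP S A) (γ : ℝ) (π : Policy S A) (s : S) : ℝ :=
  (1 - γ) * ∑' t : ℕ, γ ^ t * M.expReward π s t

/-- The return `V^π(p) = E_{s ∼ p} V^π(s)`. -/
def ret (M : MDP S A) (γ : ℝ) (π : Policy S A) : ℝ :=
  ∑ s, (M.init s).toReal * M.value γ π s

/-- `π` is an optimal policy: it maximizes the return. -/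
def IsOptimal (M : MDP S A) (γ : ℝ) (π : Policy S A) : Prop :=
  ∀ π' : Policy S A, M.ret γ π' ≤ M.ret γ π

/-- The average state distribution `d^π = (1 - γ) ∑_t γ^t d_t^π`, started from `p`. -/
def avgState (M : MDP S A) (γ : ℝ) (π : Policy S A) (s : S) : ℝ :=
  (1 - γ) * ∑' t : ℕ, γ ^ t * (M.stateLaw π M.init t s).toReal

/-- The average state-action distribution `μ^π(s, a) = d^π(s) π(a | s)`. -/
def occupancy (M : MDP S A) (γ : ℝ) (π : Policy S A) (z : S × A) : ℝ :=
  M.avgState γ π z.1 * (π z.1 z.2).toReal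

/-- The advantage function `a_v = r + (γ P - E) v / (1 - γ)`. -/
def advantage (M : MDP S A) (γ : ℝ) (v : S → ℝ) (z : S × A) : ℝ :=
  M.reward z.1 z.2 + (γ * ∑ s', (M.trans z.1 z.2 s').toReal * v s' - v z.1) / (1 - γ)

/-- The Lagrangian `L(v, μ) = pᵀ v + μᵀ a_v`. -/
def lagrangian (M : MDP S A) (γ : ℝ) (v : S → ℝ) (μ : S × A → ℝ) : ℝ :=
  ∑ s, (M.init s).toReal * v s + ∑ z, μ z * M.advantage γ v z

/-- The bifunction `F(x, x') = L(v', μ) - L(v, μ')` of the saddle-point problem. -/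
def bifun (M : MDP S A) (γ : ℝ) (x x' : Decision S A) : ℝ :=
  M.lagrangian γ x'.1 x.2 - M.lagrangian γ x.1 x'.2

/-- The relative residual `r_ep(x; x') = F(x, x) - F(x, x')`. -/
def residual (M : MDP S A) (γ : ℝ) (x x' : Decision S A) : ℝ :=
  M.bifun γ x x - M.bifun γ x x'

end MDP

/-- `π(a | s) ∝ μ(s, a)`; nothing is asked of `π(· | s)` at states `s` that `μ` does not charge. -/
def IsInducedBy {S : Type u} {A : Type v} [Fintype A] (π : Policy S A) (μ : S × A → ℝ) : Prop :=
  ∀ s a, (π s a).toReal * ∑ b, μ (s, b) = μ (s, a)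

/-! ### Linear function approximators -/

/-- The parameter set `Θ`: pairs `(θ_v, θ_μ)` with `‖θ_v‖₂ ≤ C_v / √dim θ_v`, and `θ_μ` in the
probability simplex. -/
def paramSet (dv dμ : ℕ) (Cv : ℝ) : Set (EuclideanSpace ℝ (Fin dv) × (Fin dμ → ℝ)) :=
  {θ | ‖θ.1‖ ≤ Cv / Real.sqrt dv ∧ θ.2 ∈ stdSimplex ℝ (Fin dμ)}

/-- Basis functions: `Φ s i` is the value at `s` of the `i`-th column of `Φ`, and `Ψ k` is the
`k`-th column of `Ψ`, a distribution over state-action pairs. -/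
structure Basis (S : Type u) (A : Type v) (dv dμ : ℕ) where
  Φ : S → Fin dv → ℝ
  Ψ : Fin dμ → PMF (S × A)
  Φ_le : ∀ s i, |Φ s i| ≤ 1

variable {S : Type u} {A : Type v} {dv dμ : ℕ} {Cv : ℝ}

/-- `x_θ = (Φ θ_v, Ψ θ_μ)`. -/
def Basis.decode (B : Basis S A dv dμ) (θ : paramSet dv dμ Cv) : Decision S A :=
  (fun s => ∑ i, B.Φ s i * θ.1.1 i, fun z => ∑ k, (B.Ψ k z).toReal * θ.1.2 k)

/-- `θ_μ`, viewed as a distribution over the columns of `Ψ`. -/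
def weights (θ : paramSet dv dμ Cv) : PMF (Fin dμ) :=
  PMF.ofFintype (fun k => ENNReal.ofReal (θ.1.2 k)) (by
    rw [← ENNReal.ofReal_sum_of_nonneg fun k _ => θ.2.2.1 k, θ.2.2.2, ENNReal.ofReal_one])

/-- The distribution `Ψ θ_μ` over state-action pairs, for drawing samples. -/
def Basis.mixture (B : Basis S A dv dμ) (θ : paramSet dv dμ Cv) : PMF (S × A) :=
  (weights θ).bind B.Ψ

/-- The approximation error
`ε_{Θ,N} = min_{θ ∈ Θ} r_ep(x̂; y) - r_ep(x̂; x_θ)` with `y = (v^π̂, μ^π⋆)`. -/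
def approxError [Fintype S] [Fintype A] (M : MDP S A) (γ : ℝ) (B : Basis S A dv dμ) (Cv : ℝ)
    (πstar πhat : Policy S A) (xhat : Decision S A) : ℝ :=
  ⨅ θ : paramSet dv dμ Cv,
    (M.residual γ xhat (M.value γ πhat, M.occupancy γ πstar) - M.residual γ xhat (B.decode θ))

/-! ### Randomized programs with access to a generative model -/

/-- Randomized programs that can access an MDP only through its generative model: by drawing an
initial state (`sampleInit`), or by querying a state-action pair, which returns its reward and a
sampled next state (`query`). The draws `drawPair` and `drawIndex` are the program's own
randomness. -/
inductive Prog (S : Type u) (A : Type v) (α : Type w) : Type (max u v w)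
  | done (x : α) : Prog S A α
  | sampleInit (k : S → Prog S A α) : Prog S A α
  | query (s : S) (a : A) (k : ℝ → S → Prog S A α) : Prog S A α
  | drawPair (q : PMF (S × A)) (k : S → A → Prog S A α) : Prog S A α
  | drawIndex {m : ℕ} (q : PMF (Fin m)) (k : Fin m → Prog S A α) : Prog S A α

/-- Apply a function to the result of a program. -/
def Prog.map {α : Type w} {β : Type*} (f : α → β) : Prog S A α → Prog S A β
  | .done x => .done (f x)
  | .sampleInit k => .sampleInit fun s => (k s).map f
  | .query s a k => .query s a fun r s' => (k r s').map f
  | .drawPair q k => .drawPair q fun s a => (k s a).map f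
  | .drawIndex q k => .drawIndex q fun i => (k i).map f

/-- The joint law of the result of a program on `M` and of the number of samples that it has
requested from the generative model of `M`. -/
def Prog.run {α : Type w} (M : MDP S A) : Prog S A α → PMF (α × ℕ)
  | .done x => PMF.pure (x, 0)
  | .sampleInit k => M.init.bind fun s =>
      ((k s).run M).map fun o => (o.1, o.2 + 1)
  | .query s a k => (M.trans s a).bind fun s' =>
      ((k (M.reward s a) s').run M).map fun o => (o.1, o.2 + 1)
  | .drawPair q k => q.bind fun z => (k z.1 z.2).run M
  | .drawIndex q k => q.bind fun i => (k i).run M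

/-! ### Mirror descent -/

/-- The Bregman divergence
`B_R(θ' ‖ θ) = dim(θ_v) / (2 C_v²) ‖θ'_v - θ_v‖₂² + KL(θ'_μ ‖ θ_μ)`.
(It is used only for `θ_μ > 0`; the convention `0 log 0 = 0` holds.) -/
def bregman (θ' θ : paramSet dv dμ Cv) : ℝ :=
  dv / (2 * Cv ^ 2) * ‖θ'.1.1 - θ.1.1‖ ^ 2 + ∑ k, θ'.1.2 k * Real.log (θ'.1.2 k / θ.1.2 k)

/-- The objective `⟨g, θ'⟩ + B_R(θ' ‖ θ) / η` of a mirror descent step at `θ`. -/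
def stepObjective (η : ℝ) (g : (Fin dv → ℝ) × (Fin dμ → ℝ)) (θ θ' : paramSet dv dμ Cv) : ℝ :=
  (∑ i, g.1 i * θ'.1.1 i + ∑ k, g.2 k * θ'.1.2 k) + 1 / η * bregman θ' θ

/-- The mirror descent update `argmin_{θ' ∈ Θ} ⟨g, θ'⟩ + B_R(θ' ‖ θ) / η`. -/
def mdUpdate (η : ℝ) (g : (Fin dv → ℝ) × (Fin dμ → ℝ)) (θ : paramSet dv dμ Cv) :
    paramSet dv dμ Cv :=
  @Classical.epsilon _ ⟨θ⟩ fun θ' => ∀ ϑ, stepObjective η g θ θ' ≤ stepObjective η g θ ϑ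

/-- The `v`-part of the sampled gradient, from an initial state `s₀`, a state-action pair at state
`s` drawn from `Ψ θ_μ`, and the next state `s'`. -/
def gradV (γ : ℝ) (B : Basis S A dv dμ) (s₀ s s' : S) (i : Fin dv) : ℝ :=
  B.Φ s₀ i + (γ * B.Φ s' i - B.Φ s i) / (1 - γ)

/-- The `μ`-part of the sampled gradient, from a uniform column index `k`, a state-action pair at
state `s` drawn from that column, its reward `r` and the next state `s'`. -/
def gradMu (γ : ℝ) (B : Basis S A dv dμ) (θ : paramSet dv dμ Cv) (k : Fin dμ) (s : S) (r : ℝ)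
    (s' : S) (j : Fin dμ) : ℝ :=
  if j = k then
    dμ * (1 / (1 - γ) - r - (γ * (B.decode θ).1 s' - (B.decode θ).1 s) / (1 - γ))
  else 0

/-- Mirror descent with step size `η`, started at `θ`, for `n` updates; the result is the list of
the `n + 1` iterates. -/
def mdLoop [NeZero dμ] (γ η : ℝ) (B : Basis S A dv dμ) :
    ℕ → paramSet dv dμ Cv → Prog S A (List (paramSet dv dμ Cv))
  | 0, θ => .done [θ]
  | n + 1, θ =>
    .sampleInit fun s₀ =>
    .drawPair (B.mixture θ) fun s₁ a₁ =>
    .query s₁ a₁ fun _ s₁' =>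
    .drawIndex (PMF.uniformOfFintype (Fin dμ)) fun k =>
    .drawPair (B.Ψ k) fun s₂ a₂ =>
    .query s₂ a₂ fun r₂ s₂' =>
    (mdLoop γ η B n
      (mdUpdate η (gradV γ B s₀ s₁ s₁', gradMu γ B θ k s₂ r₂ s₂') θ)).map (θ :: ·)

/-- The average `x̂ = (1/N) ∑_n x_{θ_n}` of the decisions given by a list of iterates. -/
def Basis.average (B : Basis S A dv dμ) (l : List (paramSet dv dμ Cv)) : Decision S A :=
  (l.length : ℝ)⁻¹ • (l.map B.decode).sum

/-- Mirror descent for RL with basis functions: `N` iterates `θ_1, …, θ_N` from `N - 1` updates with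
step size `η = (1 - γ) / √(N (C_v² + dim θ_μ))`; the result is the average decision `x̂_N`. -/
def mdForRL [NeZero dμ] (γ : ℝ) (B : Basis S A dv dμ) (N : ℕ) (θ₁ : paramSet dv dμ Cv) :
    Prog S A (Decision S A) :=
  (mdLoop γ ((1 - γ) / Real.sqrt (N * (Cv ^ 2 + dμ))) B (N - 1) θ₁).map B.average

end MirrorRL

end

/-! Since `F(x, x) = 0`, the residual is `r_ep(x; x') = L(v, μ') - L(v', μ)`. Against `y = (V^π̂,
μ^π⋆)` it is exactly the return gap: the flow equation makes `L(v, μ^π⋆)` equal to the return of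
`π⋆` for every `v`, and the Bellman equation makes `L(V^π̂, μ̂)` equal to the return of `π̂`
whenever `μ̂` induces `π̂` (`MDP.residual_value_occupancy`). So if `r_ep(x̂; x_θ) ≤ ε` for all `θ ∈
Θ` at once, each term of the infimum defining `ε_{Θ,N}` is at least the return gap minus `ε`, and
the theorem follows.

That uniform bound is a regret bound. The residual is affine in its first argument, so at the
average iterate it is the average of the residuals, and each of these is the conditional mean of the
pairing of the sampled gradient with `θ_n - ϑ` (`expect_gap`). Along every sequence of draws, mirror
descent bounds the sum of the pairings by an initial potential plus squared local norms of the
gradients (`mul_sum_gap_le`); the update splits into a projected Euclidean step and exponential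
weights.

What is left are centered sums. The pairing is affine in `ϑ`, so all comparators are controlled by
`2 + 2 dv + dμ` scalar statistics, counting the local norm: a union bound over these replaces one
over `Θ`, and `|S|`, `|A|` never enter. Each statistic is of size `O(dμ)`, but the large values
occur only when the right uniform index is drawn, so its second moment is `O(dμ)` rather than
`O(dμ²)`. Bernstein's inequality, by an exponential supermartingale, then gives deviations `O(√(N dμ
log(D/δ)))` with `D = dv + dμ` (`noiseLaw_exists_deviation_le`), of the same order in `N` as the
regret. Dividing by `N (1 - γ)` and solving for `N` yields the rate. -/

noncomputable section

namespace MirrorRL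

/-! ### Expectations over finite types -/

section Expect

variable {α : Type*} {β : Type*} [Fintype α]

/-- The expectation of a real function under a distribution on a finite type. -/
def expect (p : PMF α) (f : α → ℝ) : ℝ := ∑ a, (p a).toReal * f a

theorem sum_toReal_eq_one (p : PMF α) : ∑ a, (p a).toReal = 1 := by
  rw [← ENNReal.toReal_sum fun a _ => p.apply_ne_top a, ← tsum_fintype (L := .unconditional _),
    p.tsum_coe, ENNReal.toReal_one]

@[simp]
theorem expect_const (p : PMF α) (c : ℝ) : expect p (fun _ => c) = c := by
  rw [expect, ← Finset.sum_mul, sum_toReal_eq_one, one_mul]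

@[simp]
theorem expect_pure (a : α) (f : α → ℝ) : expect (PMF.pure a) f = f a := by
  classical
  rw [expect, Finset.sum_eq_single a]
  · simp
  · intro b _ hb
    simp [PMF.pure_apply, hb]
  · simp

theorem toReal_bind_apply (p : PMF α) (q : α → PMF β) (b : β) :
    (p.bind q b).toReal = expect p fun a => (q a b).toReal := by
  rw [PMF.bind_apply, tsum_fintype, ENNReal.toReal_sum]
  · simp [expect]
  · exact fun a _ => ENNReal.mul_ne_top (p.apply_ne_top a) ((q a).apply_ne_top b)

@[simp]
theorem expect_bind [Fintype β] (p : PMF α) (q : α → PMF β) (f : β → ℝ) :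
    expect (p.bind q) f = expect p fun a => expect (q a) f := by
  simp only [expect, toReal_bind_apply, Finset.sum_mul, Finset.mul_sum]
  rw [Finset.sum_comm]
  simp only [mul_assoc]

theorem expect_add (p : PMF α) (f g : α → ℝ) :
    expect p (fun a => f a + g a) = expect p f + expect p g := by
  simp [expect, mul_add, Finset.sum_add_distrib]

theorem expect_sub (p : PMF α) (f g : α → ℝ) :
    expect p (fun a => f a - g a) = expect p f - expect p g := by
  simp [expect, mul_sub, Finset.sum_sub_distrib]

theorem expect_const_mul (p : PMF α) (c : ℝ) (f : α → ℝ) :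
    expect p (fun a => c * f a) = c * expect p f := by
  simp only [expect, Finset.mul_sum]
  exact Finset.sum_congr rfl fun a _ => by ring

theorem expect_mul_const (p : PMF α) (c : ℝ) (f : α → ℝ) :
    expect p (fun a => f a * c) = expect p f * c := by
  simp only [mul_comm _ c, expect_const_mul]

theorem expect_div_const (p : PMF α) (c : ℝ) (f : α → ℝ) :
    expect p (fun a => f a / c) = expect p f / c := by
  simp only [div_eq_mul_inv, expect_mul_const]

theorem expect_neg (p : PMF α) (f : α → ℝ) : expect p (fun a => -f a) = -expect p f := by
  simp [expect]

theorem expect_mono (p : PMF α) {f g : α → ℝ} (h : ∀ a, f a ≤ g a) : expect p f ≤ expect p g :=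
  Finset.sum_le_sum fun a _ => mul_le_mul_of_nonneg_left (h a) ENNReal.toReal_nonneg

theorem expect_le (p : PMF α) {f : α → ℝ} {c : ℝ} (h : ∀ a, f a ≤ c) : expect p f ≤ c :=
  (expect_mono p h).trans_eq (expect_const p c)

theorem le_expect (p : PMF α) {f : α → ℝ} {c : ℝ} (h : ∀ a, c ≤ f a) : c ≤ expect p f :=
  (expect_const p c).symm.trans_le (expect_mono p h)

theorem abs_expect_le (p : PMF α) {f : α → ℝ} {c : ℝ} (h : ∀ a, |f a| ≤ c) : |expect p f| ≤ c :=
  abs_le.2 ⟨le_expect p fun a => (abs_le.1 (h a)).1, expect_le p fun a => (abs_le.1 (h a)).2⟩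

/-- Serves twice: for the exponential moments in Bernstein's inequality and for the normalizer of
exponential weights. -/
theorem exp_le_one_add_add_sq {x : ℝ} (hx : |x| ≤ 1) : Real.exp x ≤ 1 + x + x ^ 2 := by
  have := (abs_le.1 (Real.abs_exp_sub_one_sub_id_le hx)).2
  linarith

/-- The exponential moment bound behind Bernstein's inequality. -/
theorem expect_exp_le_one (p : PMF α) {X : α → ℝ} {c V : ℝ} (hX : ∀ a, |c * X a| ≤ 1)
    (hV : expect p (fun a => X a ^ 2) ≤ V) :
    expect p (fun a => Real.exp (c * (X a - expect p X) - c ^ 2 * V)) ≤ 1 := by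
  set m := expect p X
  -- The quadratic bound is applied to `c * X` before centering, and the mean stays in the
  -- prefactor. Hence only `X` itself must be bounded, and `V` bounds the raw second moment.
  have h1 : ∀ a, Real.exp (c * (X a - m) - c ^ 2 * V) ≤
      Real.exp (-(c * m + c ^ 2 * V)) * (1 + c * X a + c ^ 2 * X a ^ 2) := fun a => by
    rw [show c * (X a - m) - c ^ 2 * V = -(c * m + c ^ 2 * V) + c * X a by ring, Real.exp_add]
    refine mul_le_mul_of_nonneg_left ?_ (Real.exp_pos _).le
    have := exp_le_one_add_add_sq (hX a)
    rwa [mul_pow] at this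
  refine (expect_mono p h1).trans ?_
  rw [expect_const_mul, expect_add, expect_add, expect_const, expect_const_mul, expect_const_mul,
    Real.exp_neg, inv_mul_le_iff₀ (Real.exp_pos _), mul_one]
  have h2 := Real.add_one_le_exp (c * m + c ^ 2 * V)
  have h3 := mul_le_mul_of_nonneg_left hV (sq_nonneg c)
  change 1 + c * m + _ ≤ _
  linarith

end Expect

/-! ### Controlled sequences of random draws -/

section Noise

variable {Θ : Type*} {Ω : Type*} (q : Θ → PMF Ω) (upd : Θ → Ω → Θ)

/-- The law of the first `n` draws, when at state `θ` a draw `ω` has law `q θ` and leads to the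
state `upd θ ω`. -/
def noiseLaw : ℕ → Θ → PMF (List Ω)
  | 0, _ => PMF.pure []
  | n + 1, θ => (q θ).bind fun ω => (noiseLaw n (upd θ ω)).map (ω :: ·)

/-- The states, paired with the draws made there. -/
def steps : Θ → List Ω → List (Θ × Ω)
  | _, [] => []
  | θ, ω :: l => (θ, ω) :: steps (upd θ ω) l

/-- The state after the last draw. -/
def lastState : Θ → List Ω → Θ
  | θ, [] => θ
  | θ, ω :: l => lastState (upd θ ω) l

/-- All states, including the last one. -/
def iterates : Θ → List Ω → List Θ
  | θ, [] => [θ]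
  | θ, ω :: l => θ :: iterates (upd θ ω) l

theorem iterates_eq (θ : Θ) (l : List Ω) :
    iterates upd θ l = (steps upd θ l).map Prod.fst ++ [lastState upd θ l] := by
  induction l generalizing θ with
  | nil => rfl
  | cons ω l ih => simp [iterates, steps, lastState, ih]

@[simp]
theorem length_steps (θ : Θ) (l : List Ω) : (steps upd θ l).length = l.length := by
  induction l generalizing θ with
  | nil => rfl
  | cons ω l ih => simp [steps, ih]

@[simp]
theorem length_iterates (θ : Θ) (l : List Ω) : (iterates upd θ l).length = l.length + 1 := by
  simp [iterates_eq]

theorem length_of_mem_support_noiseLaw {n : ℕ} {θ : Θ} {l : List Ω}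
    (h : l ∈ (noiseLaw q upd n θ).support) : l.length = n := by
  induction n generalizing θ l with
  | zero => simp_all [noiseLaw]
  | succ n ih =>
    simp only [noiseLaw, PMF.mem_support_bind_iff, PMF.mem_support_map_iff] at h
    obtain ⟨ω, -, l', hl', rfl⟩ := h
    simp [ih hl']

/-- In `ENNReal`, interchanging sums over the infinite type of lists of draws needs no summability.
-/
theorem tsum_bind_mul {α β : Type*} (p : PMF α) (f : α → PMF β) (φ : β → ENNReal) :
    ∑' b, p.bind f b * φ b = ∑' a, p a * ∑' b, f a b * φ b := by
  simp only [PMF.bind_apply, ← ENNReal.tsum_mul_right, ← ENNReal.tsum_mul_left]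
  rw [ENNReal.tsum_comm]
  simp only [mul_assoc]

theorem tsum_map_mul {α β : Type*} (p : PMF α) (f : α → β) (φ : β → ENNReal) :
    ∑' b, p.map f b * φ b = ∑' a, p a * φ (f a) := by
  rw [PMF.map, tsum_bind_mul]
  simp

/-- Markov's inequality, free of measurability conditions. -/
theorem toOuterMeasure_le_tsum {α : Type*} (p : PMF α) (s : Set α) (φ : α → ENNReal)
    (h : ∀ a ∈ s, 1 ≤ φ a) : p.toOuterMeasure s ≤ ∑' a, p a * φ a := by
  classical
  rw [PMF.toOuterMeasure_apply]
  refine ENNReal.tsum_le_tsum fun a => ?_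
  by_cases ha : a ∈ s
  · simpa [ha] using mul_le_mul_right (h a ha) (p a)
  · simp [ha]

variable [Fintype Ω]

theorem tsum_mul_ofReal (p : PMF Ω) {f : Ω → ℝ} (hf : ∀ ω, 0 ≤ f ω) :
    ∑' ω, p ω * ENNReal.ofReal (f ω) = ENNReal.ofReal (expect p f) := by
  rw [tsum_fintype, expect, ENNReal.ofReal_sum_of_nonneg
    fun ω _ => mul_nonneg ENNReal.toReal_nonneg (hf ω)]
  refine Finset.sum_congr rfl fun ω _ => ?_
  rw [ENNReal.ofReal_mul ENNReal.toReal_nonneg, ENNReal.ofReal_toReal (p.apply_ne_top ω)]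

/-- Exponentials of sums of increments with exponential moment at most one form a
supermartingale. -/
theorem tsum_noiseLaw_exp_le_one {f : Θ × Ω → ℝ}
    (hf : ∀ θ, expect (q θ) (fun ω => Real.exp (f (θ, ω))) ≤ 1) (n : ℕ) (θ : Θ) :
    ∑' l, noiseLaw q upd n θ l * ENNReal.ofReal (Real.exp ((steps upd θ l).map f).sum) ≤ 1 := by
  induction n generalizing θ with
  | zero => simp [noiseLaw, steps]
  | succ n ih =>
    rw [noiseLaw, tsum_bind_mul]
    simp only [tsum_map_mul, steps, List.map_cons, List.sum_cons, Real.exp_add]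
    calc _ = ∑' ω, q θ ω * (ENNReal.ofReal (Real.exp (f (θ, ω))) *
          ∑' l, noiseLaw q upd n (upd θ ω) l *
            ENNReal.ofReal (Real.exp ((steps upd (upd θ ω) l).map f).sum)) := by
          refine tsum_congr fun ω => ?_
          refine congrArg (q θ ω * ·) (Eq.trans ?_ ENNReal.tsum_mul_left)
          refine tsum_congr fun l => ?_
          rw [ENNReal.ofReal_mul (Real.exp_pos _).le]
          ring
      _ ≤ ∑' ω, q θ ω * ENNReal.ofReal (Real.exp (f (θ, ω))) := by
          refine ENNReal.tsum_le_tsum fun ω => mul_le_mul_right ?_ _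
          exact (mul_le_mul_right (ih _) _).trans_eq (mul_one _)
      _ ≤ 1 := by
          rw [tsum_mul_ofReal _ fun ω => (Real.exp_pos _).le]
          exact ENNReal.ofReal_le_one.2 (hf θ)

/-- A Bernstein inequality for the sums of the centered increments of `X`. -/
theorem noiseLaw_deviation_le {X : Θ × Ω → ℝ} {c V Λ : ℝ} (hX : ∀ z, |c * X z| ≤ 1)
    (hV : ∀ θ, expect (q θ) (fun ω => X (θ, ω) ^ 2) ≤ V) (n : ℕ) (θ : Θ) :
    (noiseLaw q upd n θ).toOuterMeasure
      {l | Λ < ((steps upd θ l).map fun z =>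
        c * (X z - expect (q z.1) fun ω => X (z.1, ω)) - c ^ 2 * V).sum} ≤
      ENNReal.ofReal (Real.exp (-Λ)) := by
  set f : Θ × Ω → ℝ := fun z => c * (X z - expect (q z.1) fun ω => X (z.1, ω)) - c ^ 2 * V
  have h1 := tsum_noiseLaw_exp_le_one q upd (f := f)
    (fun θ => expect_exp_le_one (q θ) (fun ω => hX (θ, ω)) (hV θ)) n θ
  refine (toOuterMeasure_le_tsum _ _
    (fun l => ENNReal.ofReal (Real.exp (-Λ)) *
      ENNReal.ofReal (Real.exp ((steps upd θ l).map f).sum)) fun l hl => ?_).trans ?_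
  · rw [← ENNReal.ofReal_mul (Real.exp_pos _).le, ← Real.exp_add, ENNReal.one_le_ofReal,
      Real.one_le_exp_iff]
    have : Λ < _ := hl
    linarith
  · simp only [mul_left_comm _ (ENNReal.ofReal (Real.exp (-Λ))), ENNReal.tsum_mul_left]
    exact (mul_le_mul_right h1 _).trans_eq (mul_one _)

end Noise

/-! ### Value functions and occupancy measures -/

namespace MDP

variable {S : Type u} {A : Type v} (M : MDP S A) (π : Policy S A)

theorem stateLaw_eq_bind (ν : PMF S) (t : ℕ) :
    M.stateLaw π ν t = ν.bind fun s => M.stateLaw π (PMF.pure s) t := by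
  induction t with
  | zero => simp [stateLaw]
  | succ t ih =>
    simp only [stateLaw]
    rw [ih, PMF.bind_bind]

/-- Peels off the first transition where the definition peels off the last, as the Bellman equation
requires. -/
theorem stateLaw_succ' (ν : PMF S) (t : ℕ) :
    M.stateLaw π ν (t + 1) =
      M.stateLaw π (ν.bind fun s => (π s).bind fun a => M.trans s a) t := by
  induction t with
  | zero => rfl
  | succ t ih =>
    rw [stateLaw, ih]
    rfl

variable [Fintype S] {γ : ℝ}

theorem advantage_eq (v : S → ℝ) (z : S × A) :
    M.advantage γ v z =
      M.reward z.1 z.2 + (γ * expect (M.trans z.1 z.2) v - v z.1) / (1 - γ) := rfl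

variable [Fintype A]

theorem expReward_eq (s : S) (t : ℕ) :
    M.expReward π s t =
      expect (M.stateLaw π (PMF.pure s) t) fun s' => expect (π s') (M.reward s') := rfl

theorem expReward_zero (s : S) : M.expReward π s 0 = expect (π s) (M.reward s) := by
  simp [expReward_eq, stateLaw]

theorem expReward_succ (s : S) (t : ℕ) :
    M.expReward π s (t + 1) =
      expect (π s) fun a => expect (M.trans s a) fun s' => M.expReward π s' t := by
  rw [expReward_eq, stateLaw_succ', stateLaw_eq_bind]
  simp [expReward_eq]

theorem abs_expReward_le (s : S) (t : ℕ) : |M.expReward π s t| ≤ 1 := by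
  refine abs_expect_le _ fun s' => abs_expect_le _ fun a => ?_
  have := M.reward_mem s' a
  exact abs_le.2 ⟨by linarith [this.1], this.2⟩

theorem summable_geometric_mul (h0 : 0 ≤ γ) (h1 : γ < 1) {f : ℕ → ℝ} (hf : ∀ t, |f t| ≤ 1) :
    Summable fun t => γ ^ t * f t := by
  refine Summable.of_norm_bounded (summable_geometric_of_lt_one h0 h1) fun t => ?_
  rw [norm_mul, norm_pow, Real.norm_of_nonneg h0]
  exact mul_le_of_le_one_right (pow_nonneg h0 t) (hf t)

theorem summable_expect {α : Type*} [Fintype α] (p : PMF α) {f : α → ℕ → ℝ}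
    (hf : ∀ a, Summable (f a)) : Summable fun t => expect p fun a => f a t :=
  summable_sum fun a _ => (hf a).mul_left _

theorem expect_tsum {α : Type*} [Fintype α] (p : PMF α) {f : α → ℕ → ℝ}
    (hf : ∀ a, Summable (f a)) :
    (expect p fun a => ∑' t, f a t) = ∑' t, expect p fun a => f a t := by
  simp only [expect, ← tsum_mul_left]
  exact (Summable.tsum_finsetSum fun a _ => (hf a).mul_left _).symm

/-- The Bellman equation. -/
theorem value_eq (h0 : 0 ≤ γ) (h1 : γ < 1) (s : S) :
    M.value γ π s = (1 - γ) * expect (π s) (M.reward s) +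
      γ * expect (π s) fun a => expect (M.trans s a) (M.value γ π) := by
  have hs : ∀ s, Summable fun t => γ ^ t * M.expReward π s t := fun s =>
    summable_geometric_mul h0 h1 (M.abs_expReward_le π s)
  have h2 : (expect (π s) fun a => expect (M.trans s a) (M.value γ π)) =
      (1 - γ) * ∑' t, γ ^ t * M.expReward π s (t + 1) := by
    have hv : M.value γ π = fun s => (1 - γ) * ∑' t, γ ^ t * M.expReward π s t := rfl
    simp only [hv, expReward_succ, expect_const_mul, expect_tsum _ hs]
    rw [expect_tsum]
    · simp only [expect_const_mul]
    · intro a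
      have := summable_expect (M.trans s a) hs
      simpa only [expect_const_mul] using this
  rw [h2, value, (hs s).tsum_eq_zero_add, pow_zero, one_mul, expReward_zero]
  simp only [pow_succ', mul_assoc, tsum_mul_left]
  ring

/-- The flow equation of the average state distribution, tested against `f`. -/
theorem sum_avgState_mul (h0 : 0 ≤ γ) (h1 : γ < 1) (f : S → ℝ) :
    ∑ s, M.avgState γ π s * f s = (1 - γ) * expect M.init f +
      γ * ∑ s, M.avgState γ π s * expect (π s) fun a => expect (M.trans s a) f := by
  have hs : ∀ s, Summable fun t => γ ^ t * (M.stateLaw π M.init t s).toReal := fun s =>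
    summable_geometric_mul h0 h1 fun t => by
      rw [abs_of_nonneg ENNReal.toReal_nonneg]
      exact ENNReal.toReal_le_of_le_ofReal zero_le_one (by simpa using PMF.coe_le_one _ _)
  have h2 : ∀ f : S → ℝ, ∑ s, M.avgState γ π s * f s =
      (1 - γ) * ∑' t, γ ^ t * expect (M.stateLaw π M.init t) f := fun f => by
    simp only [avgState, expect, Finset.mul_sum]
    rw [Summable.tsum_finsetSum, Finset.mul_sum]
    · refine Finset.sum_congr rfl fun s _ => ?_
      rw [mul_assoc, ← tsum_mul_right]
      congr 1
      exact tsum_congr fun t => by ring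
    · intro s _
      exact ((hs s).mul_right (f s)).congr fun t => by ring
  have h3 : Summable fun t => γ ^ t * expect (M.stateLaw π M.init t) f := by
    simp only [expect, Finset.mul_sum, ← mul_assoc]
    exact summable_sum fun s _ => (hs s).mul_right (f s)
  rw [h2, h2, h3.tsum_eq_zero_add, pow_zero, one_mul]
  simp only [stateLaw, expect_bind, pow_succ', mul_assoc, tsum_mul_left]
  ring

theorem expect_advantage (v : S → ℝ) (s : S) :
    (expect (π s) fun a => M.advantage γ v (s, a)) = expect (π s) (M.reward s) +
      (γ * (expect (π s) fun a => expect (M.trans s a) v) - v s) / (1 - γ) := by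
  simp only [advantage_eq, expect_add, expect_div_const, expect_sub, expect_const_mul,
    expect_const]

/-- The Bellman equation, divided by `1 - γ`. -/
theorem expect_advantage_value (h0 : 0 ≤ γ) (h1 : γ < 1) (s : S) :
    (expect (π s) fun a => M.advantage γ (M.value γ π) (s, a)) = 0 := by
  rw [expect_advantage]
  have h2 := M.value_eq π h0 h1 s
  have h3 : 1 - γ ≠ 0 := by linarith
  field_simp
  linarith

/-- The Lagrangian at `V^π` and a measure that induces `π` is the return of `π`. -/
theorem lagrangian_value (h0 : 0 ≤ γ) (h1 : γ < 1) {μ : S × A → ℝ} (hμ : IsInducedBy π μ) :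
    M.lagrangian γ (M.value γ π) μ = M.ret γ π := by
  rw [lagrangian, ret, add_eq_left, Fintype.sum_prod_type]
  refine Finset.sum_eq_zero fun s _ => ?_
  have h2 := M.expect_advantage_value π h0 h1 s
  -- At a state of zero mass `IsInducedBy` forces `μ (s, a) = 0`, so the factorization survives
  -- whatever `π s` is there.
  calc _ = (∑ b, μ (s, b)) * expect (π s) fun a => M.advantage γ (M.value γ π) (s, a) := by
        rw [expect, Finset.mul_sum]
        refine Finset.sum_congr rfl fun a _ => ?_
        rw [← hμ s a]
        ring
    _ = 0 := by rw [h2, mul_zero]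

/-- The Lagrangian at an occupancy measure does not depend on the value function. -/
theorem lagrangian_occupancy (h0 : 0 ≤ γ) (h1 : γ < 1) (v : S → ℝ) :
    M.lagrangian γ v (M.occupancy γ π) =
      ∑ s, M.avgState γ π s * expect (π s) (M.reward s) := by
  have h2 := M.sum_avgState_mul π h0 h1 v
  have h3 : 1 - γ ≠ 0 := by linarith
  have h4 : ∑ z, M.occupancy γ π z * M.advantage γ v z =
      ∑ s, M.avgState γ π s * expect (π s) (fun a => M.advantage γ v (s, a)) := by
    rw [Fintype.sum_prod_type]
    refine Finset.sum_congr rfl fun s _ => ?_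
    rw [expect, Finset.mul_sum]
    exact Finset.sum_congr rfl fun a _ => by rw [occupancy]; ring
  rw [lagrangian, h4]
  simp only [expect_advantage, mul_add, Finset.sum_add_distrib, mul_div_assoc', mul_sub,
    ← Finset.sum_div, Finset.sum_sub_distrib, mul_left_comm _ γ, ← Finset.mul_sum]
  change expect M.init v + _ = _
  rw [h2]
  field_simp
  ring

/-- As the value does not depend on `v`, it may be computed at `v = V^π`, and the occupancy measure
of `π` induces `π`. -/
theorem lagrangian_occupancy_eq_ret (h0 : 0 ≤ γ) (h1 : γ < 1) (v : S → ℝ) :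
    M.lagrangian γ v (M.occupancy γ π) = M.ret γ π := by
  rw [M.lagrangian_occupancy π h0 h1 v, ← M.lagrangian_occupancy π h0 h1 (M.value γ π)]
  refine M.lagrangian_value π h0 h1 fun s a => ?_
  simp only [occupancy]
  rw [← Finset.mul_sum, sum_toReal_eq_one]
  ring

theorem residual_eq (x x' : Decision S A) :
    M.residual γ x x' = M.lagrangian γ x.1 x'.2 - M.lagrangian γ x'.1 x.2 := by
  simp [residual, bifun]

/-- The relative residual against `(V^π̂, μ^π)` is the difference of the returns. -/
theorem residual_value_occupancy (h0 : 0 ≤ γ) (h1 : γ < 1) (πhat : Policy S A) (x : Decision S A)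
    (hx : IsInducedBy πhat x.2) :
    M.residual γ x (M.value γ πhat, M.occupancy γ π) = M.ret γ π - M.ret γ πhat := by
  rw [residual_eq, M.lagrangian_occupancy_eq_ret π h0 h1, M.lagrangian_value πhat h0 h1 hx]

end MDP

/-! ### One step of mirror descent -/

/-- The three-point inequality for a minimizer of a linear function plus a squared distance. -/
theorem three_point_of_forall_le {E : Type*} [NormedAddCommGroup E] [InnerProductSpace ℝ E]
    {K : Set E} (hK : Convex ℝ K) {g x x' : E} {a : ℝ} (ha : 0 ≤ a) (hx' : x' ∈ K)
    (hmin : ∀ y ∈ K, inner ℝ g x' + a * ‖x' - x‖ ^ 2 ≤ inner ℝ g y + a * ‖y - x‖ ^ 2)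
    {y : E} (hy : y ∈ K) :
    inner ℝ g (x' - y) + a * ‖x' - x‖ ^ 2 + a * ‖y - x'‖ ^ 2 ≤ a * ‖y - x‖ ^ 2 := by
  -- Minimality is tested at `x' + t (y - x')`. Dividing by `t` and letting `t → 0` gives the
  -- first-order condition; inserted into the expansion at `t = 1`, it is the claim.
  have key : ∀ t : ℝ, ‖x' + t • (y - x') - x‖ ^ 2 =
      ‖x' - x‖ ^ 2 + 2 * t * inner ℝ (x' - x) (y - x') + t ^ 2 * ‖y - x'‖ ^ 2 := fun t => by
    rw [show x' + t • (y - x') - x = (x' - x) + t • (y - x') by abel, norm_add_sq_real,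
      inner_smul_right, norm_smul, mul_pow, Real.norm_eq_abs, sq_abs]
    ring
  have h1 := key 1
  rw [one_smul, add_sub_cancel] at h1
  have hgy : inner ℝ g (x' - y) = -inner ℝ g (y - x') := by rw [← inner_neg_right, neg_sub]
  set p := inner ℝ g (y - x')
  set r := inner ℝ (x' - x) (y - x')
  set B := a * ‖y - x'‖ ^ 2 with hB
  have hB0 : 0 ≤ B := by positivity
  have h2 : ∀ t : ℝ, 0 < t → t ≤ 1 → 0 ≤ p + 2 * a * r + t * B := fun t ht ht1 => by
    have h3 := hmin _ (hK.add_smul_sub_mem hx' hy ⟨ht.le, ht1⟩)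
    rw [key, inner_add_right, inner_smul_right] at h3
    change _ ≤ _ + t * p + a * (_ + 2 * t * r + _) at h3
    refine le_of_mul_le_mul_left ?_ ht
    rw [hB]
    linarith
  have h3 : 0 ≤ p + 2 * a * r := by
    refine ge_of_tendsto (f := fun t : ℝ => p + 2 * a * r + t * B)
      (x := nhdsWithin 0 (Set.Ioi 0)) ?_ ?_
    · have : Continuous fun t : ℝ => p + 2 * a * r + t * B := by fun_prop
      have := this.tendsto 0
      rw [zero_mul, add_zero] at this
      exact this.mono_left nhdsWithin_le_nhds
    · filter_upwards [Ioc_mem_nhdsGT (zero_lt_one' ℝ)] with t ht using h2 t ht.1 ht.2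
  rw [h1, hgy]
  linarith

/-- Trades the new iterate for the old one in the linear term; by Young's inequality the price `⟪g,
x - x'⟫` is absorbed by the term `a * ‖x' - x‖ ^ 2`. -/
theorem inner_le_of_three_point {E : Type*} [NormedAddCommGroup E] [InnerProductSpace ℝ E]
    {g x x' y : E} {a : ℝ} (ha : 0 < a)
    (h : inner ℝ g (x' - y) + a * ‖x' - x‖ ^ 2 + a * ‖y - x'‖ ^ 2 ≤ a * ‖y - x‖ ^ 2) :
    inner ℝ g (x - y) ≤ a * ‖y - x‖ ^ 2 - a * ‖y - x'‖ ^ 2 + ‖g‖ ^ 2 / (4 * a) := by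
  have h1 : inner ℝ g (x - y) = inner ℝ g (x' - y) - inner ℝ g (x' - x) := by
    rw [← inner_sub_right]
    congr 1
    abel
  have h2 : -inner ℝ g (x' - x) ≤ ‖g‖ * ‖x' - x‖ :=
    (neg_le_abs _).trans (abs_real_inner_le_norm _ _)
  have h3 : ‖g‖ * ‖x' - x‖ ≤ a * ‖x' - x‖ ^ 2 + ‖g‖ ^ 2 / (4 * a) := by
    have : a * ‖x' - x‖ ^ 2 + ‖g‖ ^ 2 / (4 * a) - ‖g‖ * ‖x' - x‖ =
        (2 * a * ‖x' - x‖ - ‖g‖) ^ 2 / (4 * a) := by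
      field_simp
      ring
    have h4 : 0 ≤ (2 * a * ‖x' - x‖ - ‖g‖) ^ 2 / (4 * a) := by positivity
    linarith
  linarith

/-! ### Relative entropy and exponential weights on the simplex. -/

section Simplex

variable {ι : Type*} [Fintype ι]

/-- Both vectors have total mass one, so the terms by which `klFun x` differs from `x log x` cancel.
The relative entropy thus becomes a sum of nonnegative terms. -/
theorem sum_mul_klFun {q w : ι → ℝ} (hq : q ∈ stdSimplex ℝ ι) (hw : w ∈ stdSimplex ℝ ι)
    (hw0 : ∀ k, 0 < w k) :
    ∑ k, w k * InformationTheory.klFun (q k / w k) = ∑ k, q k * Real.log (q k / w k) := by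
  have : ∀ k, w k * InformationTheory.klFun (q k / w k) =
      q k * Real.log (q k / w k) + w k - q k := fun k => by
    rw [InformationTheory.klFun]
    have := (hw0 k).ne'
    field_simp
  simp only [this, Finset.sum_sub_distrib, Finset.sum_add_distrib, hq.2, hw.2]
  ring

/-- The equality case of Gibbs' inequality, since `klFun` vanishes only at `1`. -/
theorem eq_of_sum_mul_log_div_nonpos {q w : ι → ℝ} (hq : q ∈ stdSimplex ℝ ι)
    (hw : w ∈ stdSimplex ℝ ι) (hw0 : ∀ k, 0 < w k) (h : ∑ k, q k * Real.log (q k / w k) ≤ 0) :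
    q = w := by
  rw [← sum_mul_klFun hq hw hw0] at h
  have hnn : ∀ k ∈ Finset.univ, 0 ≤ w k * InformationTheory.klFun (q k / w k) := fun k _ =>
    mul_nonneg (hw0 k).le (InformationTheory.klFun_nonneg (div_nonneg (hq.1 k) (hw0 k).le))
  have h1 := (Finset.sum_eq_zero_iff_of_nonneg hnn).1 (le_antisymm h (Finset.sum_nonneg hnn))
  funext k
  have h2 := (mul_eq_zero.1 (h1 k (Finset.mem_univ k))).resolve_left (hw0 k).ne'
  rw [InformationTheory.klFun_eq_zero_iff (div_nonneg (hq.1 k) (hw0 k).le)] at h2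
  exact (div_eq_one_iff_eq (hw0 k).ne').1 h2

/-- The exponential weights update of `θ` with losses `c`. -/
def expWeights (c θ : ι → ℝ) (k : ι) : ℝ :=
  θ k * Real.exp (-c k) / ∑ j, θ j * Real.exp (-c j)

variable {c θ : ι → ℝ}

theorem sum_mul_exp_pos (hθ : θ ∈ stdSimplex ℝ ι) (hθ0 : ∀ k, 0 < θ k) :
    0 < ∑ j, θ j * Real.exp (-c j) := by
  refine Finset.sum_pos (fun j _ => mul_pos (hθ0 j) (Real.exp_pos _)) ?_
  by_contra h
  have := hθ.2
  rw [Finset.not_nonempty_iff_eq_empty.1 h] at this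
  simp at this

theorem expWeights_pos (hθ : θ ∈ stdSimplex ℝ ι) (hθ0 : ∀ k, 0 < θ k) (k : ι) :
    0 < expWeights c θ k :=
  div_pos (mul_pos (hθ0 k) (Real.exp_pos _)) (sum_mul_exp_pos hθ hθ0)

theorem expWeights_mem (hθ : θ ∈ stdSimplex ℝ ι) (hθ0 : ∀ k, 0 < θ k) :
    expWeights c θ ∈ stdSimplex ℝ ι := by
  refine ⟨fun k => (expWeights_pos hθ hθ0 k).le, ?_⟩
  simp only [expWeights]
  rw [← Finset.sum_div, div_self (sum_mul_exp_pos hθ hθ0).ne']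

theorem log_expWeights (hθ : θ ∈ stdSimplex ℝ ι) (hθ0 : ∀ k, 0 < θ k) (k : ι) :
    Real.log (expWeights c θ k) =
      Real.log (θ k) - c k - Real.log (∑ j, θ j * Real.exp (-c j)) := by
  rw [expWeights, Real.log_div (mul_pos (hθ0 k) (Real.exp_pos _)).ne' (sum_mul_exp_pos hθ hθ0).ne',
    Real.log_mul (hθ0 k).ne' (Real.exp_pos _).ne', Real.log_exp]
  ring

/-- Completing the square for entropy: up to a constant, the step objective is the divergence from
`expWeights c θ`, which is therefore its only minimizer. -/
theorem sum_mul_add_klDiv_eq (hθ : θ ∈ stdSimplex ℝ ι) (hθ0 : ∀ k, 0 < θ k) {q : ι → ℝ}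
    (hq : q ∈ stdSimplex ℝ ι) :
    ∑ k, c k * q k + ∑ k, q k * Real.log (q k / θ k) =
      ∑ k, q k * Real.log (q k / expWeights c θ k) -
        Real.log (∑ j, θ j * Real.exp (-c j)) := by
  set Z := ∑ j, θ j * Real.exp (-c j) with hZ
  have h1 : ∀ k, c k * q k + q k * Real.log (q k / θ k) =
      q k * Real.log (q k / expWeights c θ k) - q k * Real.log Z := fun k => by
    rcases (hq.1 k).eq_or_lt with h | h
    · simp [← h]
    · rw [Real.log_div h.ne' (hθ0 k).ne', Real.log_div h.ne' (expWeights_pos hθ hθ0 k).ne',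
        log_expWeights hθ hθ0]
      ring
  rw [← Finset.sum_add_distrib, Finset.sum_congr rfl fun k _ => h1 k, Finset.sum_sub_distrib,
    ← Finset.sum_mul, hq.2, one_mul]

/-- The one-step regret of exponential weights. -/
theorem sum_mul_sub_le_expWeights (hθ : θ ∈ stdSimplex ℝ ι) (hθ0 : ∀ k, 0 < θ k)
    (hc : ∀ k, |c k| ≤ 1) {q : ι → ℝ} (hq : q ∈ stdSimplex ℝ ι) :
    ∑ k, c k * (θ k - q k) ≤ ∑ k, q k * Real.log (expWeights c θ k) -
      ∑ k, q k * Real.log (θ k) + ∑ k, θ k * c k ^ 2 := by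
  simp only [log_expWeights hθ hθ0, mul_sub, Finset.sum_sub_distrib, ← Finset.sum_mul, hq.2]
  have h1 : ∑ j, θ j * Real.exp (-c j) ≤ 1 - ∑ j, c j * θ j + ∑ j, θ j * c j ^ 2 := by
    calc _ ≤ ∑ j, (θ j - c j * θ j + θ j * c j ^ 2) := by
          refine Finset.sum_le_sum fun j _ => ?_
          have := mul_le_mul_of_nonneg_left
            (exp_le_one_add_add_sq (x := -c j) (by rw [abs_neg]; exact hc j)) (hθ0 j).le
          linarith
      _ = _ := by rw [Finset.sum_add_distrib, Finset.sum_sub_distrib, hθ.2]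
  have h2 := Real.log_le_sub_one_of_pos (sum_mul_exp_pos (c := c) hθ hθ0)
  have h3 : ∑ k, c k * q k = ∑ k, q k * c k := Finset.sum_congr rfl fun k _ => mul_comm _ _
  linarith

end Simplex

/-! ### The mirror descent update and its regret. -/

variable {dv dμ : ℕ} {Cv : ℝ}

theorem sum_mul_eq_inner (g : Fin dv → ℝ) (x : EuclideanSpace ℝ (Fin dv)) :
    ∑ i, g i * x i = inner ℝ (WithLp.toLp 2 g) x := by
  simp [PiLp.inner_apply, mul_comm]

theorem sum_sq_eq_norm_sq (g : Fin dv → ℝ) : ∑ i, g i ^ 2 = ‖WithLp.toLp 2 g‖ ^ 2 := by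
  simp [EuclideanSpace.norm_sq_eq]

/-- `mdUpdate` is a `Classical.epsilon` and says nothing until a minimizer is known to exist. The
objective separates: compactness of the ball gives one half, exponential weights the other. -/
theorem exists_forall_stepObjective_le {η : ℝ} (hη : 0 < η)
    (g : (Fin dv → ℝ) × (Fin dμ → ℝ)) (θ : paramSet dv dμ Cv) (hθ : ∀ k, 0 < θ.1.2 k) :
    ∃ θ' : paramSet dv dμ Cv, ∀ ϑ, stepObjective η g θ θ' ≤ stepObjective η g θ ϑ := by
  obtain ⟨x, hx, hmin⟩ := (isCompact_closedBall (0 : EuclideanSpace ℝ (Fin dv))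
    (Cv / Real.sqrt dv)).exists_isMinOn ⟨θ.1.1, by simpa using θ.2.1⟩
    (f := fun x => inner ℝ (WithLp.toLp 2 g.1) x +
      1 / η * (dv / (2 * Cv ^ 2) * ‖x - θ.1.1‖ ^ 2)) (by fun_prop)
  have hw := expWeights_mem (c := fun k => η * g.2 k) θ.2.2 hθ
  have hw0 := expWeights_pos (c := fun k => η * g.2 k) θ.2.2 hθ
  refine ⟨⟨(x, expWeights (fun k => η * g.2 k) θ.1.2), by simpa using hx, hw⟩, fun ϑ => ?_⟩
  have h1 := hmin (show ϑ.1.1 ∈ _ by simpa using ϑ.2.1)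
  simp only [Set.mem_ofPred_eq] at h1
  have h2 := sum_mul_add_klDiv_eq (c := fun k => η * g.2 k) θ.2.2 hθ hw
  have h3 := sum_mul_add_klDiv_eq (c := fun k => η * g.2 k) θ.2.2 hθ ϑ.2.2
  have h4 : ∑ k, ϑ.1.2 k * Real.log (ϑ.1.2 k / expWeights (fun k => η * g.2 k) θ.1.2 k) ≥ 0 := by
    rw [← sum_mul_klFun ϑ.2.2 hw hw0]
    exact Finset.sum_nonneg fun k _ => mul_nonneg (hw0 k).le
      (InformationTheory.klFun_nonneg (div_nonneg (ϑ.2.2.1 k) (hw0 k).le))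
  simp only [div_self (hw0 _).ne', Real.log_one, mul_zero, Finset.sum_const_zero] at h2
  simp only [mul_assoc, ← Finset.mul_sum] at h2 h3
  have h5 : ∀ a b : ℝ, a + 1 / η * b = 1 / η * (η * a + b) := fun a b => by field_simp
  have h6 := mul_le_mul_of_nonneg_left (h2.trans_le (by linarith only [h3, h4]) :
    _ ≤ η * ∑ k, g.2 k * ϑ.1.2 k + ∑ k, ϑ.1.2 k * Real.log (ϑ.1.2 k / θ.1.2 k))
    (one_div_pos.2 hη).le
  rw [← h5, ← h5] at h6
  simp only [stepObjective, bregman, sum_mul_eq_inner] at h6 ⊢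
  linarith

theorem stepObjective_mdUpdate_le {η : ℝ} (hη : 0 < η)
    (g : (Fin dv → ℝ) × (Fin dμ → ℝ)) (θ : paramSet dv dμ Cv) (hθ : ∀ k, 0 < θ.1.2 k)
    (ϑ : paramSet dv dμ Cv) :
    stepObjective η g θ (mdUpdate η g θ) ≤ stepObjective η g θ ϑ :=
  Classical.epsilon_spec (exists_forall_stepObjective_le hη g θ hθ) ϑ

/-- The update of the weights is the exponential weights update. -/
theorem mdUpdate_snd {η : ℝ} (hη : 0 < η)
    (g : (Fin dv → ℝ) × (Fin dμ → ℝ)) (θ : paramSet dv dμ Cv) (hθ : ∀ k, 0 < θ.1.2 k) :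
    (mdUpdate η g θ).1.2 = expWeights (fun k => η * g.2 k) θ.1.2 := by
  have hw := expWeights_mem (c := fun k => η * g.2 k) θ.2.2 hθ
  have hw0 := expWeights_pos (c := fun k => η * g.2 k) θ.2.2 hθ
  set θ' := mdUpdate η g θ with hθ'
  refine eq_of_sum_mul_log_div_nonpos θ'.2.2 hw hw0 ?_
  -- The competitor keeps the `v`-part, so only the entropy parts are compared.
  have h1 := stepObjective_mdUpdate_le hη g θ hθ
    ⟨(θ'.1.1, expWeights (fun k => η * g.2 k) θ.1.2), θ'.2.1, hw⟩
  rw [← hθ'] at h1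
  simp only [stepObjective, bregman] at h1
  have h2 := sum_mul_add_klDiv_eq (c := fun k => η * g.2 k) θ.2.2 hθ hw
  have h3 := sum_mul_add_klDiv_eq (c := fun k => η * g.2 k) θ.2.2 hθ θ'.2.2
  simp only [div_self (hw0 _).ne', Real.log_one, mul_zero, Finset.sum_const_zero] at h2
  simp only [mul_assoc, ← Finset.mul_sum] at h2 h3
  have h5 : ∀ a b : ℝ, η * a + b = η * (a + 1 / η * b) := fun a b => by field_simp
  rw [h5] at h2 h3
  have h6 := mul_le_mul_of_nonneg_left (show _ + _ ≤ _ + _ by linarith only [h1] :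
    ∑ k, g.2 k * θ'.1.2 k + 1 / η * ∑ k, θ'.1.2 k * Real.log (θ'.1.2 k / θ.1.2 k) ≤
    ∑ k, g.2 k * expWeights (fun k => η * g.2 k) θ.1.2 k +
      1 / η * ∑ k, expWeights (fun k => η * g.2 k) θ.1.2 k *
        Real.log (expWeights (fun k => η * g.2 k) θ.1.2 k / θ.1.2 k)) hη.le
  rw [h2, h3] at h6
  linarith

theorem mdUpdate_pos {η : ℝ} (hη : 0 < η)
    (g : (Fin dv → ℝ) × (Fin dμ → ℝ)) (θ : paramSet dv dμ Cv) (hθ : ∀ k, 0 < θ.1.2 k)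
    (k : Fin dμ) : 0 < (mdUpdate η g θ).1.2 k := by
  rw [mdUpdate_snd hη g θ hθ]
  exact expWeights_pos θ.2.2 hθ k

/-- The three-point inequality on the ball with `a = dv / (2 Cv² η)`. -/
theorem mdUpdate_fst_regret [NeZero dv] (hCv : 0 < Cv) {η : ℝ} (hη : 0 < η)
    (g : (Fin dv → ℝ) × (Fin dμ → ℝ)) (θ : paramSet dv dμ Cv) (hθ : ∀ k, 0 < θ.1.2 k)
    (ϑ : paramSet dv dμ Cv) :
    η * ∑ i, g.1 i * (θ.1.1 - ϑ.1.1) i ≤ dv / (2 * Cv ^ 2) * ‖ϑ.1.1 - θ.1.1‖ ^ 2 -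
      dv / (2 * Cv ^ 2) * ‖ϑ.1.1 - (mdUpdate η g θ).1.1‖ ^ 2 +
      η ^ 2 * (Cv ^ 2 / (2 * dv) * ∑ i, g.1 i ^ 2) := by
  have hdv : (0 : ℝ) < dv := Nat.cast_pos.2 (NeZero.pos dv)
  set θ' := mdUpdate η g θ with hθ'
  have ha : 0 < 1 / η * (dv / (2 * Cv ^ 2)) := by positivity
  have h1 := three_point_of_forall_le
    (convex_closedBall (0 : EuclideanSpace ℝ (Fin dv)) (Cv / Real.sqrt dv))
    (g := WithLp.toLp 2 g.1) (x := θ.1.1) (x' := θ'.1.1) ha.le (by simpa using θ'.2.1)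
    (fun y hy => by
      have h2 := stepObjective_mdUpdate_le hη g θ hθ
        ⟨(y, θ'.1.2), by simpa using hy, θ'.2.2⟩
      rw [← hθ'] at h2
      simp only [stepObjective, bregman, sum_mul_eq_inner] at h2
      linarith)
    (y := ϑ.1.1) (by simpa using ϑ.2.1)
  have h3 := mul_le_mul_of_nonneg_left (inner_le_of_three_point ha h1) hη.le
  rw [sum_mul_eq_inner, sum_sq_eq_norm_sq]
  refine h3.trans_eq ?_
  field_simp
  ring

/-- The potential of the regret analysis of mirror descent with comparator `ϑ`. -/
def potential (ϑ θ : paramSet dv dμ Cv) : ℝ :=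
  dv / (2 * Cv ^ 2) * ‖ϑ.1.1 - θ.1.1‖ ^ 2 - ∑ k, ϑ.1.2 k * Real.log (θ.1.2 k)

/-- The pairing of a gradient with a difference of parameters. -/
def gap (g : (Fin dv → ℝ) × (Fin dμ → ℝ)) (θ ϑ : paramSet dv dμ Cv) : ℝ :=
  ∑ i, g.1 i * (θ.1.1 i - ϑ.1.1 i) + ∑ k, g.2 k * (θ.1.2 k - ϑ.1.2 k)

/-- The one-step regret of mirror descent. -/
theorem mul_gap_le [NeZero dv] (hCv : 0 < Cv) {η : ℝ} (hη : 0 < η)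
    (g : (Fin dv → ℝ) × (Fin dμ → ℝ)) (θ : paramSet dv dμ Cv) (hθ : ∀ k, 0 < θ.1.2 k)
    (hg : ∀ k, |η * g.2 k| ≤ 1) (ϑ : paramSet dv dμ Cv) :
    η * gap g θ ϑ ≤ potential ϑ θ - potential ϑ (mdUpdate η g θ) +
      η ^ 2 * (Cv ^ 2 / (2 * dv) * ∑ i, g.1 i ^ 2 + ∑ k, θ.1.2 k * g.2 k ^ 2) := by
  have h1 := mdUpdate_fst_regret hCv hη g θ hθ ϑ
  have h2 := sum_mul_sub_le_expWeights θ.2.2 hθ hg ϑ.2.2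
  rw [← mdUpdate_snd hη g θ hθ] at h2
  simp only [mul_assoc, ← Finset.mul_sum, mul_pow, mul_left_comm _ (η ^ 2)] at h2
  simp only [PiLp.sub_apply] at h1
  simp only [gap, potential]
  linarith

/-- The potential uses cross entropy instead of relative entropy. They differ by a term in `ϑ`
alone, so differences agree, and nonnegativity only needs weights at most one. -/
theorem potential_nonneg {ϑ θ : paramSet dv dμ Cv} (hθ : ∀ k, 0 < θ.1.2 k) :
    0 ≤ potential ϑ θ := by
  have h1 : ∑ k, ϑ.1.2 k * Real.log (θ.1.2 k) ≤ 0 :=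
    Finset.sum_nonpos fun k _ => mul_nonpos_of_nonneg_of_nonpos (ϑ.2.2.1 k)
      (Real.log_nonpos (hθ k).le (mem_Icc_of_mem_stdSimplex θ.2.2 k).2)
  have h2 : 0 ≤ (dv : ℝ) / (2 * Cv ^ 2) * ‖ϑ.1.1 - θ.1.1‖ ^ 2 := by positivity
  rw [potential]
  linarith

/-- The ball has diameter `2 Cv / √dv`, and the cross entropy relative to uniform weights is `log
dμ`. -/
theorem potential_le [NeZero dv] (hCv : 0 < Cv) {ϑ θ : paramSet dv dμ Cv}
    (hθ : ∀ k, θ.1.2 k = 1 / dμ) : potential ϑ θ ≤ 2 + Real.log dμ := by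
  have hdv : (0 : ℝ) < dv := Nat.cast_pos.2 (NeZero.pos dv)
  have h1 : ∑ k, ϑ.1.2 k * Real.log (θ.1.2 k) = -Real.log dμ := by
    simp only [hθ, one_div, Real.log_inv]
    rw [← Finset.sum_mul, ϑ.2.2.2, one_mul]
  have h2 : ‖ϑ.1.1 - θ.1.1‖ ≤ 2 * (Cv / Real.sqrt dv) := by
    have := norm_sub_le ϑ.1.1 θ.1.1
    linarith [ϑ.2.1, θ.2.1]
  have h3 : dv / (2 * Cv ^ 2) * ‖ϑ.1.1 - θ.1.1‖ ^ 2 ≤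
      dv / (2 * Cv ^ 2) * (2 * (Cv / Real.sqrt dv)) ^ 2 := by gcongr
  have h4 : dv / (2 * Cv ^ 2) * (2 * (Cv / Real.sqrt dv)) ^ 2 = 2 := by
    rw [mul_pow, div_pow, Real.sq_sqrt hdv.le]
    field_simp
  rw [potential, h1]
  linarith

/-- The regret of mirror descent along a sequence of draws. -/
theorem mul_sum_gap_le [NeZero dv] {Ω : Type*} (hCv : 0 < Cv) {η : ℝ} (hη : 0 < η)
    (grad : paramSet dv dμ Cv × Ω → (Fin dv → ℝ) × (Fin dμ → ℝ))
    (hg : ∀ z k, |η * (grad z).2 k| ≤ 1) (ϑ : paramSet dv dμ Cv) (l : List Ω)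
    (θ : paramSet dv dμ Cv) (hθ : ∀ k, 0 < θ.1.2 k) :
    ((steps (fun θ ω => mdUpdate η (grad (θ, ω)) θ) θ l).map fun z =>
      η * gap (grad z) z.1 ϑ - η ^ 2 * (Cv ^ 2 / (2 * dv) * ∑ i, (grad z).1 i ^ 2 +
        ∑ k, z.1.1.2 k * (grad z).2 k ^ 2)).sum ≤ potential ϑ θ := by
  induction l generalizing θ with
  | nil => simpa [steps] using potential_nonneg hθ
  | cons ω l ih =>
    have h1 := ih _ (mdUpdate_pos hη (grad (θ, ω)) θ hθ)
    have h2 := mul_gap_le hCv hη (grad (θ, ω)) θ hθ (hg (θ, ω)) ϑ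
    simp only [steps, List.map_cons, List.sum_cons]
    linarith

/-! ### The draws of mirror descent -/

section Run

variable {S : Type u} {A : Type v}

theorem Prog.run_map {α : Type*} {β : Type*} (M : MDP S A) (f : α → β) (P : Prog S A α) :
    (P.map f).run M = (P.run M).map fun o => (f o.1, o.2) := by
  induction P with
  | done x => simp [Prog.map, Prog.run, PMF.pure_map]
  | sampleInit k ih => simp [Prog.map, Prog.run, ih, PMF.map_bind, PMF.map_comp, Function.comp_def]
  | query s a k ih => simp [Prog.map, Prog.run, ih, PMF.map_bind, PMF.map_comp, Function.comp_def]
  | drawPair q k ih => simp [Prog.map, Prog.run, ih, PMF.map_bind]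
  | drawIndex q k ih => simp [Prog.map, Prog.run, ih, PMF.map_bind]

variable {dv dμ : ℕ} {Cv : ℝ}

/-- The draws made in one round: an initial state, a state-action pair from the current mixture and
its next state, and a column index, a state-action pair from that column and its next state. -/
abbrev Noise (S : Type u) (A : Type v) (dμ : ℕ) := S × (S × A) × S × Fin dμ × (S × A) × S

/-- The law of the draws made in one round at `θ`. -/
def noiseKernel [NeZero dμ] (M : MDP S A) (B : Basis S A dv dμ) (θ : paramSet dv dμ Cv) :
    PMF (Noise S A dμ) :=
  M.init.bind fun s₀ =>
  (B.mixture θ).bind fun z₁ =>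
  (M.trans z₁.1 z₁.2).bind fun s₁ =>
  (PMF.uniformOfFintype (Fin dμ)).bind fun k =>
  (B.Ψ k).bind fun z₂ =>
  (M.trans z₂.1 z₂.2).bind fun s₂ =>
  PMF.pure (s₀, z₁, s₁, k, z₂, s₂)

/-- The sampled gradient at a parameter, for given draws. -/
def noiseGrad (γ : ℝ) (M : MDP S A) (B : Basis S A dv dμ) (z : paramSet dv dμ Cv × Noise S A dμ) :
    (Fin dv → ℝ) × (Fin dμ → ℝ) :=
  (gradV γ B z.2.1 z.2.2.1.1 z.2.2.2.1,
    gradMu γ B z.1 z.2.2.2.2.1 z.2.2.2.2.2.1.1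
      (M.reward z.2.2.2.2.2.1.1 z.2.2.2.2.2.1.2) z.2.2.2.2.2.2)

/-- The update of mirror descent, as a function of the draws. -/
def noiseUpdate (γ η : ℝ) (M : MDP S A) (B : Basis S A dv dμ) (θ : paramSet dv dμ Cv)
    (ω : Noise S A dμ) : paramSet dv dμ Cv :=
  mdUpdate η (noiseGrad γ M B (θ, ω)) θ

/-- The law of the result of mirror descent and of its number of samples. -/
theorem run_mdLoop [NeZero dμ] (γ η : ℝ) (M : MDP S A) (B : Basis S A dv dμ) (n : ℕ)
    (θ : paramSet dv dμ Cv) :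
    (mdLoop γ η B n θ).run M =
      (noiseLaw (noiseKernel M B) (noiseUpdate γ η M B) n θ).map fun l =>
        (iterates (noiseUpdate γ η M B) θ l, 3 * n) := by
  induction n generalizing θ with
  | zero => simp [mdLoop, Prog.run, noiseLaw, PMF.pure_map, iterates]
  | succ n ih =>
    simp [mdLoop, Prog.run, Prog.run_map, ih, noiseLaw, noiseKernel, PMF.map_bind, PMF.map_comp,
      Function.comp_def, iterates, noiseUpdate, noiseGrad, mul_add]

theorem run_mdForRL [NeZero dμ] (γ : ℝ) (M : MDP S A) (B : Basis S A dv dμ) (N : ℕ)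
    (θ : paramSet dv dμ Cv) :
    (mdForRL γ B N θ).run M =
      (noiseLaw (noiseKernel M B)
        (noiseUpdate γ ((1 - γ) / Real.sqrt (N * (Cv ^ 2 + dμ))) M B) (N - 1) θ).map fun l =>
        (B.average (iterates
          (noiseUpdate γ ((1 - γ) / Real.sqrt (N * (Cv ^ 2 + dμ))) M B) θ l), 3 * (N - 1)) := by
  rw [mdForRL, Prog.run_map, run_mdLoop, PMF.map_comp]
  rfl

end Run

/-! ### Bounds for gradients -/

section Bounds

variable {S : Type u} {A : Type v} {dv dμ : ℕ} {Cv γ : ℝ}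

/-- Cauchy–Schwarz: the `√dv` from passing to the sup norm cancels against the radius of the ball.
Coordinatewise bounds thus suffice without loss in `dv`. -/
theorem abs_sum_mul_le [NeZero dv] {x : EuclideanSpace ℝ (Fin dv)} (hx : ‖x‖ ≤ Cv / Real.sqrt dv)
    {a : Fin dv → ℝ} {R : ℝ} (hR : 0 ≤ R) (ha : ∀ i, |a i| ≤ R) : |∑ i, a i * x i| ≤ Cv * R := by
  have hdv : (0 : ℝ) < dv := Nat.cast_pos.2 (NeZero.pos dv)
  have h1 : ‖WithLp.toLp 2 a‖ ≤ Real.sqrt dv * R := by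
    refine abs_le_of_sq_le_sq' ?_ (by positivity) |>.2
    rw [← sum_sq_eq_norm_sq, mul_pow, Real.sq_sqrt hdv.le]
    calc _ ≤ ∑ _i : Fin dv, R ^ 2 := Finset.sum_le_sum fun i _ => sq_le_sq' (abs_le.1 (ha i)).1
          (abs_le.1 (ha i)).2
      _ = _ := by simp
  rw [sum_mul_eq_inner]
  calc _ ≤ ‖WithLp.toLp 2 a‖ * ‖x‖ := abs_real_inner_le_norm _ _
    _ ≤ (Real.sqrt dv * R) * (Cv / Real.sqrt dv) := by gcongr
    _ = Cv * R := by field_simp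

theorem abs_decode_fst_le [NeZero dv] (B : Basis S A dv dμ) (θ : paramSet dv dμ Cv) (s : S) :
    |(B.decode θ).1 s| ≤ Cv :=
  (abs_sum_mul_le θ.2.1 zero_le_one (B.Φ_le s)).trans_eq (mul_one Cv)

theorem abs_gradV_le (h0 : 0 ≤ γ) (h1 : γ < 1) (B : Basis S A dv dμ) (s₀ s s' : S) (i : Fin dv) :
    |(1 - γ) * gradV γ B s₀ s s' i| ≤ 2 := by
  have h2 : (1 - γ) * gradV γ B s₀ s s' i = (1 - γ) * B.Φ s₀ i + (γ * B.Φ s' i - B.Φ s i) := by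
    have : 1 - γ ≠ 0 := by linarith
    rw [gradV]
    field_simp
  have h3 := abs_le.1 (B.Φ_le s₀ i)
  have h4 := abs_le.1 (B.Φ_le s' i)
  have h5 := abs_le.1 (B.Φ_le s i)
  have h6 : 0 ≤ 1 - γ := by linarith
  rw [h2]
  exact abs_le.2 ⟨by nlinarith, by nlinarith⟩

theorem abs_gradMu_le [NeZero dv] (h0 : 0 ≤ γ) (h1 : γ < 1) (B : Basis S A dv dμ)
    (θ : paramSet dv dμ Cv) (k : Fin dμ) (s : S) {r : ℝ} (hr : r ∈ Set.Icc (0 : ℝ) 1) (s' : S)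
    (j : Fin dμ) :
    |(1 - γ) * gradMu γ B θ k s r s' j| ≤ if j = k then dμ * (2 + 2 * Cv) else 0 := by
  rw [gradMu]
  split_ifs
  · have h2 : ∀ a b : ℝ, (1 - γ) * (dμ * (1 / (1 - γ) - r - (γ * a - b) / (1 - γ))) =
        dμ * (1 - (1 - γ) * r - (γ * a - b)) := fun a b => by
      have : 1 - γ ≠ 0 := by linarith
      field_simp
    have h3 := abs_le.1 (abs_decode_fst_le B θ s)
    have h4 := abs_le.1 (abs_decode_fst_le B θ s')
    have h5 : 0 ≤ 1 - γ := by linarith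
    have h6 : 0 ≤ (1 - γ) * r := mul_nonneg h5 hr.1
    have h7 : (1 - γ) * r ≤ 1 := mul_le_one₀ (by linarith) hr.1 hr.2
    rw [h2, abs_mul, Nat.abs_cast]
    refine mul_le_mul_of_nonneg_left ?_ (Nat.cast_nonneg _)
    exact abs_le.2 ⟨by nlinarith, by nlinarith⟩
  · simp

end Bounds

/-! ### Expected gradients -/

section Grad

variable {S : Type u} {A : Type v} {dv dμ : ℕ} {Cv γ : ℝ}

/-- The basis functions recombine into `u`, and only the drawn index survives in the `μ`-part. In
this form the expectation can be taken one draw at a time. -/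
theorem gap_noiseGrad (M : MDP S A) (B : Basis S A dv dμ) (ϑ : paramSet dv dμ Cv)
    (z : paramSet dv dμ Cv × Noise S A dμ) {u : S → ℝ}
    (hu : u = (B.decode z.1).1 - (B.decode ϑ).1) :
    gap (noiseGrad γ M B z) z.1 ϑ =
      u z.2.1 + (γ * u z.2.2.2.1 - u z.2.2.1.1) / (1 - γ) +
      dμ * ((1 / (1 - γ) - M.reward z.2.2.2.2.2.1.1 z.2.2.2.2.2.1.2 -
        (γ * (B.decode z.1).1 z.2.2.2.2.2.2 - (B.decode z.1).1 z.2.2.2.2.2.1.1) / (1 - γ)) *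
        (z.1.1.2 z.2.2.2.2.1 - ϑ.1.2 z.2.2.2.2.1)) := by
  have hu' : ∀ s, u s = ∑ i, B.Φ s i * (z.1.1.1 i - ϑ.1.1 i) := fun s => by
    rw [hu]
    simp [Basis.decode, mul_sub]
  rw [gap]
  congr 1
  · simp only [hu', noiseGrad, gradV, Finset.mul_sum, ← Finset.sum_sub_distrib, Finset.sum_div,
      ← Finset.sum_add_distrib]
    exact Finset.sum_congr rfl fun i _ => by ring
  · simp only [noiseGrad, gradMu, ite_mul, zero_mul, Finset.sum_ite_eq', Finset.mem_univ, if_true,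
      mul_assoc]

variable [Fintype S] [Fintype A]

theorem toReal_weights (θ : paramSet dv dμ Cv) (k : Fin dμ) : (weights θ k).toReal = θ.1.2 k := by
  simp [weights, ENNReal.toReal_ofReal (θ.2.2.1 k)]

theorem expect_mixture (B : Basis S A dv dμ) (θ : paramSet dv dμ Cv) (f : S × A → ℝ) :
    expect (B.mixture θ) f = ∑ k, θ.1.2 k * expect (B.Ψ k) f := by
  rw [Basis.mixture, expect_bind, expect]
  simp only [toReal_weights]

theorem sum_decode_snd_mul (B : Basis S A dv dμ) (θ : paramSet dv dμ Cv) (f : S × A → ℝ) :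
    ∑ z, (B.decode θ).2 z * f z = expect (B.mixture θ) f := by
  rw [expect]
  refine Finset.sum_congr rfl fun z _ => ?_
  rw [Basis.mixture, toReal_bind_apply, expect, Basis.decode]
  simp only [toReal_weights, mul_comm]

theorem lagrangian_decode (M : MDP S A) (B : Basis S A dv dμ) (v : S → ℝ)
    (θ : paramSet dv dμ Cv) :
    M.lagrangian γ v (B.decode θ).2 = expect M.init v + expect (B.mixture θ) (M.advantage γ v) := by
  rw [MDP.lagrangian, sum_decode_snd_mul]
  rfl

theorem expect_uniform [NeZero dμ] (f : Fin dμ → ℝ) :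
    expect (PMF.uniformOfFintype (Fin dμ)) f = (∑ k, f k) / dμ := by
  simp [expect, ← Finset.mul_sum, div_eq_inv_mul]

/-- The expected gap is the residual. -/
theorem expect_gap [NeZero dμ] (M : MDP S A) (B : Basis S A dv dμ) (θ ϑ : paramSet dv dμ Cv) :
    (expect (noiseKernel M B θ) fun ω => gap (noiseGrad γ M B (θ, ω)) θ ϑ) =
      M.residual γ (B.decode θ) (B.decode ϑ) := by
  have hd : (dμ : ℝ) ≠ 0 := NeZero.ne _
  have h1 : ∀ ω : Noise S A dμ, _ := fun ω => gap_noiseGrad (γ := γ) M B ϑ (θ, ω) rfl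
  simp only [h1, noiseKernel, expect_bind, expect_pure, expect_add, expect_sub, expect_const,
    expect_div_const, expect_const_mul, expect_uniform, expect_mul_const, Pi.sub_apply]
  -- The importance weight `dμ` cancels the probability `1 / dμ` of each index.
  rw [mul_div_cancel₀ _ hd, MDP.residual_eq, lagrangian_decode, lagrangian_decode]
  have h2 : ∀ v : S → ℝ, M.advantage γ v = fun z => M.reward z.1 z.2 +
      (γ * expect (M.trans z.1 z.2) v - v z.1) / (1 - γ) := fun v => rfl
  simp only [h2, expect_add, expect_sub, expect_div_const, expect_const_mul]
  simp only [expect_mixture, mul_sub, sub_div, Finset.sum_sub_distrib]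
  -- The weights sum to one, so the baseline `1 / (1 - γ)` contributes equally for `θ` and `ϑ` and
  -- drops out.
  have h3 : ∀ (τ : paramSet dv dμ Cv) (a e f : Fin dμ → ℝ) (c : ℝ),
      ∑ k, ((1 / c - a k) - (γ * e k / c - f k / c)) * τ.1.2 k =
        1 / c - ∑ k, τ.1.2 k * a k -
          (γ * (∑ k, τ.1.2 k * e k) / c - (∑ k, τ.1.2 k * f k) / c) := fun τ a e f c => by
    have h4 : ∑ k, τ.1.2 k * (1 / c) = 1 / c := by rw [← Finset.sum_mul, τ.2.2.2, one_mul]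
    nth_rewrite 2 [← h4]
    simp only [Finset.mul_sum, Finset.sum_div, ← Finset.sum_sub_distrib]
    exact Finset.sum_congr rfl fun k _ => by ring
  rw [h3, h3]
  ring

theorem abs_lagrangian_decode_le [NeZero dv] (h0 : 0 ≤ γ) (h1 : γ < 1) (M : MDP S A)
    (B : Basis S A dv dμ) (θ ϑ : paramSet dv dμ Cv) :
    |(1 - γ) * M.lagrangian γ (B.decode θ).1 (B.decode ϑ).2| ≤ 2 + 2 * Cv := by
  have h2 : 0 < 1 - γ := by linarith
  have h3 : |expect M.init (B.decode θ).1| ≤ Cv := abs_expect_le _ (abs_decode_fst_le B θ)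
  have h4 : |expect (B.mixture ϑ) (M.advantage γ (B.decode θ).1)| ≤
      1 + (γ * Cv + Cv) / (1 - γ) := by
    refine abs_expect_le _ fun z => ?_
    rw [MDP.advantage_eq]
    have h5 := M.reward_mem z.1 z.2
    have h6 := abs_le.1 (abs_expect_le (M.trans z.1 z.2) (abs_decode_fst_le B θ))
    have h7 := abs_le.1 (abs_decode_fst_le B θ z.1)
    refine (abs_add_le _ _).trans (add_le_add ?_ ?_)
    · exact abs_le.2 ⟨by linarith [h5.1], h5.2⟩
    · rw [abs_div, abs_of_pos h2]
      refine div_le_div_of_nonneg_right ?_ h2.le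
      exact abs_le.2 ⟨by nlinarith, by nlinarith⟩
  have h5 : (1 - γ) * ((γ * Cv + Cv) / (1 - γ)) = γ * Cv + Cv := by field_simp
  rw [lagrangian_decode, abs_mul, abs_of_pos h2]
  have h6 := mul_le_mul_of_nonneg_left ((abs_add_le _ _).trans (add_le_add h3 h4)) h2.le
  rw [mul_add, mul_add, h5] at h6
  linarith

/-- The residual between two decisions of the parametrized class is of order `1 / (1 - γ)`. -/
theorem residual_decode_le [NeZero dv] (h0 : 0 ≤ γ) (h1 : γ < 1) (M : MDP S A)
    (B : Basis S A dv dμ) (θ ϑ : paramSet dv dμ Cv) :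
    (1 - γ) * M.residual γ (B.decode θ) (B.decode ϑ) ≤ 2 * (2 + 2 * Cv) := by
  have h2 := abs_le.1 (abs_lagrangian_decode_le h0 h1 M B θ ϑ)
  have h3 := abs_le.1 (abs_lagrangian_decode_le h0 h1 M B ϑ θ)
  rw [MDP.residual_eq, mul_sub]
  linarith [h2.2, h3.1]

/-- The linear part of the residual in its first argument. -/
def residualLinear (M : MDP S A) (γ : ℝ) (y : Decision S A) : Decision S A →ₗ[ℝ] ℝ where
  toFun x := expect M.init x.1 +
    ∑ z, y.2 z * ((γ * expect (M.trans z.1 z.2) x.1 - x.1 z.1) / (1 - γ)) -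
    ∑ z, x.2 z * M.advantage γ y.1 z
  map_add' x x' := by
    have h : ∀ p : PMF S, expect p (x.1 + x'.1) = expect p x.1 + expect p x'.1 := fun p =>
      expect_add p x.1 x'.1
    simp only [Prod.fst_add, Prod.snd_add, h, Pi.add_apply, add_mul, Finset.sum_add_distrib]
    have h2 : ∑ z, y.2 z * ((γ * (expect (M.trans z.1 z.2) x.1 + expect (M.trans z.1 z.2) x'.1) -
        (x.1 z.1 + x'.1 z.1)) / (1 - γ)) =
        ∑ z, y.2 z * ((γ * expect (M.trans z.1 z.2) x.1 - x.1 z.1) / (1 - γ)) +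
        ∑ z, y.2 z * ((γ * expect (M.trans z.1 z.2) x'.1 - x'.1 z.1) / (1 - γ)) := by
      rw [← Finset.sum_add_distrib]
      exact Finset.sum_congr rfl fun z _ => by ring
    rw [h2]
    ring
  map_smul' c x := by
    have h : ∀ p : PMF S, expect p (c • x.1) = c * expect p x.1 := fun p =>
      expect_const_mul p c x.1
    simp only [Prod.smul_fst, Prod.smul_snd, h, Pi.smul_apply, smul_eq_mul, RingHom.id_apply,
      mul_sub, mul_add, Finset.mul_sum]
    congr 1
    · congr 1
      exact Finset.sum_congr rfl fun z _ => by ring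
    · exact Finset.sum_congr rfl fun z _ => by ring

theorem residual_eq_add (M : MDP S A) (x y : Decision S A) :
    M.residual γ x y = residualLinear M γ y x +
      (∑ z, y.2 z * M.reward z.1 z.2 - expect M.init y.1) := by
  have h : M.lagrangian γ x.1 y.2 = expect M.init x.1 + (∑ z, y.2 z * M.reward z.1 z.2 +
      ∑ z, y.2 z * ((γ * expect (M.trans z.1 z.2) x.1 - x.1 z.1) / (1 - γ))) := by
    rw [← Finset.sum_add_distrib]
    simp only [← mul_add]
    rfl
  have h2 : M.lagrangian γ y.1 x.2 = expect M.init y.1 + ∑ z, x.2 z * M.advantage γ y.1 z := rfl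
  rw [MDP.residual_eq, h, h2]
  simp only [residualLinear, LinearMap.coe_mk, AddHom.coe_mk]
  ring

/-- The residual of an average is the average of the residuals. -/
theorem length_mul_residual_average (M : MDP S A) (B : Basis S A dv dμ) (y : Decision S A)
    {l : List (paramSet dv dμ Cv)} (hl : l ≠ []) :
    l.length * M.residual γ (B.average l) y =
      (l.map fun θ => M.residual γ (B.decode θ) y).sum := by
  have h1 : (l.length : ℝ) ≠ 0 := by simpa using hl
  have h2 : ∀ (f : paramSet dv dμ Cv → ℝ) (c : ℝ) (l : List (paramSet dv dμ Cv)),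
      (l.map fun θ => f θ + c).sum = (l.map f).sum + l.length * c := fun f c l => by
    induction l with
    | nil => simp
    | cons a l ih =>
      simp only [List.map_cons, List.sum_cons, ih, List.length_cons]
      push_cast
      ring
  simp only [residual_eq_add, h2]
  rw [Basis.average, map_smul, map_list_sum, List.map_map, smul_eq_mul, mul_add,
    mul_inv_cancel_left₀ h1]
  rfl

end Grad

/-! ### Deviations along the draws -/

section Deviation

variable {Θ : Type*} {Ω : Type*} [Fintype Ω] (q : Θ → PMF Ω)

/-- The sum of the centered values of `X` along a list of states and draws. -/
def deviation (L : List (Θ × Ω)) (X : Θ × Ω → ℝ) : ℝ :=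
  (L.map fun z => X z - expect (q z.1) fun ω => X (z.1, ω)).sum

theorem deviation_add (L : List (Θ × Ω)) (X Y : Θ × Ω → ℝ) :
    deviation q L (fun z => X z + Y z) = deviation q L X + deviation q L Y := by
  simp only [deviation, expect_add]
  induction L with
  | nil => simp
  | cons z L ih =>
    simp only [List.map_cons, List.sum_cons, ih]
    ring

theorem deviation_const_mul (L : List (Θ × Ω)) (c : ℝ) (X : Θ × Ω → ℝ) :
    deviation q L (fun z => c * X z) = c * deviation q L X := by
  simp only [deviation, expect_const_mul, ← mul_sub, List.sum_map_mul_left]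

theorem deviation_sum {ι : Type*} (L : List (Θ × Ω)) (s : Finset ι) (X : ι → Θ × Ω → ℝ) :
    deviation q L (fun z => ∑ i ∈ s, X i z) = ∑ i ∈ s, deviation q L (X i) := by
  classical
  induction s using Finset.induction_on with
  | empty => simp [deviation]
  | insert a s ha ih =>
    simp only [Finset.sum_insert ha]
    rw [deviation_add, ih]

theorem sum_eq_deviation_add (L : List (Θ × Ω)) (X : Θ × Ω → ℝ) :
    (L.map X).sum = deviation q L X + (L.map fun z => expect (q z.1) fun ω => X (z.1, ω)).sum := by
  rw [deviation]
  induction L with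
  | nil => simp
  | cons z L ih =>
    simp only [List.map_cons, List.sum_cons, ih]
    ring

theorem sum_map_le_length_mul {α : Type*} (L : List α) {f : α → ℝ} {c : ℝ} (h : ∀ a, f a ≤ c) :
    (L.map f).sum ≤ L.length * c := by
  simpa using List.sum_le_card_nsmul (L.map f) c (by simpa using fun a _ => h a)

/-- Bernstein's inequality in the form used for all gradient statistics. -/
theorem noiseLaw_deviation_gt_le (upd : Θ → Ω → Θ) {X : Θ × Ω → ℝ} {b d Λ N : ℝ} (hb : 0 < b)
    (hd : 0 < d) (hΛ : 0 < Λ) (hN : d * Λ ≤ N) (hX : ∀ z, |X z| ≤ 2 * b * d)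
    (hV : ∀ θ, expect (q θ) (fun ω => X (θ, ω) ^ 2) ≤ 4 * b ^ 2 * d) (n : ℕ) (θ : Θ) :
    (noiseLaw q upd n θ).toOuterMeasure
      {l | l.length ≤ N ∧ 4 * b * Real.sqrt (N * d * Λ) < deviation q (steps upd θ l) X} ≤
      ENNReal.ofReal (Real.exp (-Λ)) := by
  have hN0 : 0 < N := (mul_pos hd hΛ).trans_le hN
  -- This `c` minimizes `Λ / c + c N V` with `V = 4 b² d`: both terms equal `2 b √(N d Λ)`. The
  -- condition `d Λ ≤ N` is what makes `|c X| ≤ 1`.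
  set c := Real.sqrt (N * d * Λ) / (2 * b * N * d) with hc
  have hc0 : 0 < c := by positivity
  have hsq : Real.sqrt (N * d * Λ) ^ 2 = N * d * Λ := Real.sq_sqrt (by positivity)
  have hc2 : c ^ 2 * (4 * b ^ 2 * d) = Λ / N := by
    rw [hc, div_pow, hsq]
    field_simp
    norm_num
  have hc3 : c * (4 * b * Real.sqrt (N * d * Λ)) = 2 * Λ := by
    rw [hc]
    calc _ = 2 * Real.sqrt (N * d * Λ) ^ 2 / (N * d) := by field_simp; norm_num
      _ = _ := by rw [hsq]; field_simp
  have hc4 : c * (2 * b * d) ≤ 1 := by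
    have : Real.sqrt (N * d * Λ) ≤ N := Real.sqrt_le_iff.2 ⟨hN0.le, by nlinarith⟩
    calc _ = Real.sqrt (N * d * Λ) / N := by rw [hc]; field_simp
      _ ≤ 1 := (div_le_one hN0).2 this
  refine le_trans ((noiseLaw q upd n θ).toOuterMeasure.mono ?_)
    (noiseLaw_deviation_le q upd (c := c) (X := X) (fun z => ?_) hV n θ)
  · rintro l ⟨hl, hdev⟩
    have h1 : ∀ (L : List (Θ × Ω)) (f : Θ × Ω → ℝ) (e : ℝ),
        (L.map fun z => c * f z - e).sum = c * (L.map f).sum - L.length * e := fun L f e => by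
      induction L with
      | nil => simp
      | cons z L ih =>
        simp only [List.map_cons, List.sum_cons, ih, List.length_cons]
        push_cast
        ring
    change Λ < _
    rw [h1, length_steps, hc2]
    have h2 := mul_lt_mul_of_pos_left hdev hc0
    rw [hc3] at h2
    have h3 : l.length * (Λ / N) ≤ Λ := by
      calc _ ≤ N * (Λ / N) := by gcongr
        _ = Λ := by field_simp
    rw [deviation] at h2
    linarith
  · rw [abs_mul, abs_of_pos hc0]
    exact (mul_le_mul_of_nonneg_left (hX z) hc0.le).trans hc4

end Deviation

/-! ### Statistics of the sampled gradients -/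

section Statistics

variable {S : Type u} {A : Type v} {dv dμ : ℕ} {Cv γ : ℝ}

/-- The column index drawn in a round. -/
def Noise.index (ω : Noise S A dμ) : Fin dμ := ω.2.2.2.1

/-- Statistics of a round whose deviations are controlled: they are bounded by a multiple of `dμ`,
and their squares exceed a constant only where the drawn index carries weight. -/
def IsModerate (b : ℝ) (X : paramSet dv dμ Cv × Noise S A dμ → ℝ) : Prop :=
  (∀ z, |X z| ≤ 2 * b * dμ) ∧ ∃ w : paramSet dv dμ Cv → Fin dμ → ℝ, (∀ θ, ∑ k, w θ k ≤ 1) ∧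
    ∀ z, X z ^ 2 ≤ 2 * b ^ 2 + 2 * b ^ 2 * dμ ^ 2 * w z.1 z.2.index

theorem one_le_cast [NeZero dμ] : (1 : ℝ) ≤ dμ := Nat.one_le_cast.2 (NeZero.pos dμ)

theorem abs_noiseGrad_fst_le (h0 : 0 ≤ γ) (h1 : γ < 1) (M : MDP S A) (B : Basis S A dv dμ)
    (z : paramSet dv dμ Cv × Noise S A dμ) (i : Fin dv) :
    |(1 - γ) * (noiseGrad γ M B z).1 i| ≤ 2 :=
  abs_gradV_le h0 h1 B _ _ _ i

theorem abs_noiseGrad_snd_le [NeZero dv] (h0 : 0 ≤ γ) (h1 : γ < 1) (M : MDP S A)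
    (B : Basis S A dv dμ) (z : paramSet dv dμ Cv × Noise S A dμ) (k : Fin dμ) :
    |(1 - γ) * (noiseGrad γ M B z).2 k| ≤ if k = z.2.index then dμ * (2 + 2 * Cv) else 0 :=
  abs_gradMu_le h0 h1 B _ _ _ (M.reward_mem _ _) _ k

theorem abs_noiseGrad_snd_le' [NeZero dv] (h0 : 0 ≤ γ) (h1 : γ < 1) (hCv : 0 < Cv) (M : MDP S A)
    (B : Basis S A dv dμ) (z : paramSet dv dμ Cv × Noise S A dμ) (k : Fin dμ) :
    |(1 - γ) * (noiseGrad γ M B z).2 k| ≤ dμ * (2 + 2 * Cv) := by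
  refine (abs_noiseGrad_snd_le h0 h1 M B z k).trans ?_
  split_ifs
  · rfl
  · positivity

theorem sum_noiseGrad_snd (M : MDP S A) (B : Basis S A dv dμ)
    (z : paramSet dv dμ Cv × Noise S A dμ) (F : Fin dμ → ℝ → ℝ) (hF : ∀ k, F k 0 = 0) :
    ∑ k, F k ((noiseGrad γ M B z).2 k) = F z.2.index ((noiseGrad γ M B z).2 z.2.index) := by
  refine Finset.sum_eq_single _ (fun k _ hk => ?_) (by simp)
  have : (noiseGrad γ M B z).2 k = 0 := if_neg hk
  rw [this, hF]

/-- The scaled pairing of the gradient with the current parameter, negated. -/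
def pairStat (γ : ℝ) (M : MDP S A) (B : Basis S A dv dμ)
    (z : paramSet dv dμ Cv × Noise S A dμ) : ℝ :=
  -((1 - γ) * (∑ i, (noiseGrad γ M B z).1 i * z.1.1.1 i + ∑ k, (noiseGrad γ M B z).2 k * z.1.1.2 k))

/-- The scaled local norm of the gradient. -/
def quadStat (γ : ℝ) (M : MDP S A) (B : Basis S A dv dμ)
    (z : paramSet dv dμ Cv × Noise S A dμ) : ℝ :=
  (∑ k, z.1.1.2 k * ((1 - γ) * (noiseGrad γ M B z).2 k) ^ 2) / (dμ * (2 + 2 * Cv))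

theorem isModerate_noiseGrad_fst [NeZero dμ] (h0 : 0 ≤ γ) (h1 : γ < 1) (hCv : 0 < Cv)
    (M : MDP S A) (B : Basis S A dv dμ) (i : Fin dv) {c : ℝ} (hc : |c| = 1) :
    IsModerate (Cv := Cv) (2 + 2 * Cv) fun z => c * ((1 - γ) * (noiseGrad γ M B z).1 i) := by
  have hd : (1 : ℝ) ≤ dμ := one_le_cast
  have h2 : ∀ z : paramSet dv dμ Cv × Noise S A dμ,
      |c * ((1 - γ) * (noiseGrad γ M B z).1 i)| ≤ 2 := fun z => by
    rw [abs_mul, hc, one_mul]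
    exact abs_noiseGrad_fst_le h0 h1 M B z i
  refine ⟨fun z => (h2 z).trans (by nlinarith), fun _ _ => 0, by simp, fun z => ?_⟩
  rw [← sq_abs]
  have := pow_le_pow_left₀ (abs_nonneg _) (h2 z) 2
  nlinarith

theorem isModerate_noiseGrad_snd [NeZero dv] [NeZero dμ] (h0 : 0 ≤ γ) (h1 : γ < 1) (hCv : 0 < Cv)
    (M : MDP S A) (B : Basis S A dv dμ) (k : Fin dμ) :
    IsModerate (Cv := Cv) (2 + 2 * Cv) fun z => (1 - γ) * (noiseGrad γ M B z).2 k := by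
  have hd : (1 : ℝ) ≤ dμ := one_le_cast
  refine ⟨fun z => (abs_noiseGrad_snd_le' h0 h1 hCv M B z k).trans (by nlinarith),
    fun _ j => if k = j then 1 else 0, by simp, fun z => ?_⟩
  have h2 := abs_noiseGrad_snd_le h0 h1 M B z k
  rw [← sq_abs]
  have := pow_le_pow_left₀ (abs_nonneg _) h2 2
  refine this.trans ?_
  simp only
  split_ifs
  · rw [mul_pow]
    nlinarith [sq_nonneg ((dμ : ℝ) * (2 + 2 * Cv)), sq_nonneg (2 + 2 * Cv)]
  · simp only [ne_eq, OfNat.ofNat_ne_zero, not_false_eq_true, zero_pow]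
    positivity

/-- The `v`-part is bounded by `b`. The `μ`-part carries the weight `t` of the drawn index, and `t²
≤ t` leaves a single power of it in the square. -/
theorem isModerate_pairStat [NeZero dv] [NeZero dμ] (h0 : 0 ≤ γ) (h1 : γ < 1) (hCv : 0 < Cv)
    (M : MDP S A) (B : Basis S A dv dμ) :
    IsModerate (Cv := Cv) (2 + 2 * Cv) (pairStat γ M B) := by
  have hd : (1 : ℝ) ≤ dμ := one_le_cast
  set b := 2 + 2 * Cv with hb
  have hb0 : 0 < b := by positivity
  have key : ∀ z : paramSet dv dμ Cv × Noise S A dμ, ∃ p m : ℝ, pairStat γ M B z = -(p + m) ∧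
      |p| ≤ b ∧ |m| ≤ dμ * b * z.1.1.2 z.2.index := fun z => by
    refine ⟨∑ i, ((1 - γ) * (noiseGrad γ M B z).1 i) * z.1.1.1 i,
      ∑ k, ((1 - γ) * (noiseGrad γ M B z).2 k) * z.1.1.2 k, ?_, ?_, ?_⟩
    · simp only [pairStat, mul_assoc, ← Finset.mul_sum, ← mul_add]
    · refine (abs_sum_mul_le z.1.2.1 zero_le_two (abs_noiseGrad_fst_le h0 h1 M B z)).trans ?_
      linarith
    · rw [sum_noiseGrad_snd M B z (fun k x => ((1 - γ) * x) * z.1.1.2 k) (by simp), abs_mul,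
        abs_of_nonneg (z.1.2.2.1 _)]
      exact mul_le_mul_of_nonneg_right (abs_noiseGrad_snd_le' h0 h1 hCv M B z _) (z.1.2.2.1 _)
  refine ⟨fun z => ?_, fun θ => θ.1.2, fun θ => θ.2.2.2.le, fun z => ?_⟩
  · obtain ⟨p, m, h, hp, hm⟩ := key z
    rw [h, abs_neg]
    have h2 : dμ * b * z.1.1.2 z.2.index ≤ dμ * b :=
      mul_le_of_le_one_right (by positivity) (mem_Icc_of_mem_stdSimplex z.1.2.2 _).2
    refine (abs_add_le _ _).trans ?_
    nlinarith
  · obtain ⟨p, m, h, hp, hm⟩ := key z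
    obtain ⟨ht0, ht1⟩ := mem_Icc_of_mem_stdSimplex z.1.2.2 z.2.index
    set t := z.1.1.2 z.2.index
    have h2 : p ^ 2 ≤ b ^ 2 := sq_le_sq' (abs_le.1 hp).1 (abs_le.1 hp).2
    have h3 : m ^ 2 ≤ (dμ * b * t) ^ 2 := sq_le_sq' (abs_le.1 hm).1 (abs_le.1 hm).2
    have h4 : (dμ * b * t) ^ 2 ≤ b ^ 2 * dμ ^ 2 * t := by
      calc _ = b ^ 2 * dμ ^ 2 * t * t := by ring
        _ ≤ b ^ 2 * dμ ^ 2 * t := mul_le_of_le_one_right (by positivity) ht1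
    rw [h]
    nlinarith [sq_nonneg (p - m)]

/-- Only the drawn index contributes; the normalization removes one of the two factors `dμ (2 + 2
Cv)`. -/
theorem quadStat_nonneg_le [NeZero dv] [NeZero dμ] (h0 : 0 ≤ γ) (h1 : γ < 1) (hCv : 0 < Cv)
    (M : MDP S A) (B : Basis S A dv dμ) (z : paramSet dv dμ Cv × Noise S A dμ) :
    0 ≤ quadStat γ M B z ∧
      quadStat γ M B z ≤ dμ * (2 + 2 * Cv) * z.1.1.2 z.2.index := by
  have hd : (1 : ℝ) ≤ dμ := one_le_cast
  have hp : 0 < dμ * (2 + 2 * Cv) := by positivity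
  have ht0 := z.1.2.2.1 z.2.index
  rw [quadStat, sum_noiseGrad_snd M B z (fun k x => z.1.1.2 k * ((1 - γ) * x) ^ 2) (by simp)]
  refine ⟨by positivity, (div_le_iff₀ hp).2 ?_⟩
  have h2 := pow_le_pow_left₀ (abs_nonneg _) (abs_noiseGrad_snd_le' h0 h1 hCv M B z z.2.index) 2
  rw [sq_abs] at h2
  have := mul_le_mul_of_nonneg_left h2 ht0
  linarith

theorem isModerate_quadStat [NeZero dv] [NeZero dμ] (h0 : 0 ≤ γ) (h1 : γ < 1) (hCv : 0 < Cv)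
    (M : MDP S A) (B : Basis S A dv dμ) :
    IsModerate (Cv := Cv) (2 + 2 * Cv) (quadStat γ M B) := by
  have hd : (1 : ℝ) ≤ dμ := one_le_cast
  set b := 2 + 2 * Cv with hb
  have hb0 : 0 < b := by positivity
  refine ⟨fun z => ?_, fun θ => θ.1.2, fun θ => θ.2.2.2.le, fun z => ?_⟩
  · obtain ⟨h2, h3⟩ := quadStat_nonneg_le h0 h1 hCv M B z
    have h4 : dμ * b * z.1.1.2 z.2.index ≤ dμ * b :=
      mul_le_of_le_one_right (by positivity) (mem_Icc_of_mem_stdSimplex z.1.2.2 _).2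
    rw [abs_of_nonneg h2]
    nlinarith
  · obtain ⟨h2, h3⟩ := quadStat_nonneg_le h0 h1 hCv M B z
    obtain ⟨ht0, ht1⟩ := mem_Icc_of_mem_stdSimplex z.1.2.2 z.2.index
    set t := z.1.1.2 z.2.index
    have h4 : (dμ * b * t) ^ 2 ≤ b ^ 2 * dμ ^ 2 * t := by
      calc _ = b ^ 2 * dμ ^ 2 * t * t := by ring
        _ ≤ b ^ 2 * dμ ^ 2 * t := mul_le_of_le_one_right (by positivity) ht1
    have h5 := pow_le_pow_left₀ h2 h3 2
    have h6 : 0 ≤ b ^ 2 * dμ ^ 2 * t := by positivity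
    nlinarith [sq_nonneg b]

/-- The index set of the statistics that enter the regret bound. -/
abbrev StatIndex (dv dμ : ℕ) := (Bool ⊕ Fin dv) ⊕ (Fin dv ⊕ Fin dμ)

/-- The statistics that enter the regret bound. -/
def stat (γ : ℝ) (M : MDP S A) (B : Basis S A dv dμ) :
    StatIndex dv dμ → paramSet dv dμ Cv × Noise S A dμ → ℝ
  | .inl (.inl false) => pairStat γ M B
  | .inl (.inl true) => quadStat γ M B
  | .inl (.inr i) => fun z => 1 * ((1 - γ) * (noiseGrad γ M B z).1 i)
  | .inr (.inl i) => fun z => (-1) * ((1 - γ) * (noiseGrad γ M B z).1 i)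
  | .inr (.inr k) => fun z => (1 - γ) * (noiseGrad γ M B z).2 k

theorem isModerate_stat [NeZero dv] [NeZero dμ] (h0 : 0 ≤ γ) (h1 : γ < 1) (hCv : 0 < Cv)
    (M : MDP S A) (B : Basis S A dv dμ) (j : StatIndex dv dμ) :
    IsModerate (Cv := Cv) (2 + 2 * Cv) (stat γ M B j) := by
  rcases j with ((_ | _) | i) | (i | k)
  · exact isModerate_pairStat h0 h1 hCv M B
  · exact isModerate_quadStat h0 h1 hCv M B
  · exact isModerate_noiseGrad_fst h0 h1 hCv M B i (by simp)
  · exact isModerate_noiseGrad_fst h0 h1 hCv M B i (by simp)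
  · exact isModerate_noiseGrad_snd h0 h1 hCv M B k

variable [Fintype S] [Fintype A]

theorem expect_index [NeZero dμ] (M : MDP S A) (B : Basis S A dv dμ) (θ : paramSet dv dμ Cv)
    (f : Fin dμ → ℝ) : (expect (noiseKernel M B θ) fun ω => f ω.index) = (∑ k, f k) / dμ := by
  simp [noiseKernel, Noise.index, expect_uniform]

/-- The index is uniform, so the large values contribute `2 b² dμ² (∑ w) / dμ`, a factor `dμ` below
the squared sup bound. This makes the final rate linear in `dμ`. -/
theorem IsModerate.expect_sq_le [NeZero dμ] {b : ℝ} {X : paramSet dv dμ Cv × Noise S A dμ → ℝ}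
    (hX : IsModerate b X) (M : MDP S A) (B : Basis S A dv dμ) (θ : paramSet dv dμ Cv) :
    (expect (noiseKernel M B θ) fun ω => X (θ, ω) ^ 2) ≤ 4 * b ^ 2 * dμ := by
  have hd : (1 : ℝ) ≤ dμ := one_le_cast
  obtain ⟨-, w, hw, h⟩ := hX
  refine (expect_mono _ fun ω => h (θ, ω)).trans ?_
  simp only
  rw [expect_add, expect_const, expect_const_mul, expect_index]
  have h2 : 2 * b ^ 2 * dμ ^ 2 * ((∑ k, w θ k) / dμ) = 2 * b ^ 2 * dμ * ∑ k, w θ k := by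
    field_simp
  rw [h2]
  have h3 : 2 * b ^ 2 * dμ * ∑ k, w θ k ≤ 2 * b ^ 2 * dμ :=
    mul_le_of_le_one_right (by positivity) (hw θ)
  nlinarith [sq_nonneg b]

theorem expect_quadStat_le [NeZero dv] [NeZero dμ] (h0 : 0 ≤ γ) (h1 : γ < 1) (hCv : 0 < Cv)
    (M : MDP S A) (B : Basis S A dv dμ) (θ : paramSet dv dμ Cv) :
    (expect (noiseKernel M B θ) fun ω => quadStat γ M B (θ, ω)) ≤ 2 + 2 * Cv := by
  have hd : (0 : ℝ) < dμ := zero_lt_one.trans_le one_le_cast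
  refine (expect_mono _ fun ω => (quadStat_nonneg_le h0 h1 hCv M B (θ, ω)).2).trans_eq ?_
  simp only
  rw [expect_const_mul, expect_index, θ.2.2.2]
  field_simp

/-- With high probability, all statistics deviate little from their means. -/
theorem noiseLaw_exists_deviation_le [NeZero dv] [NeZero dμ] (h0 : 0 ≤ γ) (h1 : γ < 1)
    (hCv : 0 < Cv) (M : MDP S A) (B : Basis S A dv dμ)
    (upd : paramSet dv dμ Cv → Noise S A dμ → paramSet dv dμ Cv) {Λ N : ℝ} (hΛ : 0 < Λ)
    (hN : dμ * Λ ≤ N) (n : ℕ) (θ : paramSet dv dμ Cv) :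
    (noiseLaw (noiseKernel M B) upd n θ).toOuterMeasure
      {l | l.length ≤ N ∧ ∃ j, 4 * (2 + 2 * Cv) * Real.sqrt (N * dμ * Λ) <
        deviation (noiseKernel M B) (steps upd θ l) (stat γ M B j)} ≤
      ENNReal.ofReal (4 * (dv + dμ : ℕ) * Real.exp (-Λ)) := by
  have hd : (0 : ℝ) < dμ := zero_lt_one.trans_le one_le_cast
  have h2 : {l : List (Noise S A dμ) | l.length ≤ N ∧
      ∃ j, 4 * (2 + 2 * Cv) * Real.sqrt (N * dμ * Λ) <
        deviation (noiseKernel M B) (steps upd θ l) (stat γ M B j)} =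
      ⋃ j, {l | l.length ≤ N ∧ 4 * (2 + 2 * Cv) * Real.sqrt (N * dμ * Λ) <
        deviation (noiseKernel M B) (steps upd θ l) (stat γ M B j)} := by
    ext l
    simp
  rw [h2]
  refine (MeasureTheory.measure_iUnion_fintype_le _ _).trans ((Finset.sum_le_sum fun j _ =>
    noiseLaw_deviation_gt_le (noiseKernel M B) upd (by positivity) hd hΛ hN
      (isModerate_stat h0 h1 hCv M B j).1
      ((isModerate_stat h0 h1 hCv M B j).expect_sq_le M B) n θ).trans ?_)
  rw [Finset.sum_const, nsmul_eq_mul, ENNReal.ofReal_mul (by positivity)]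
  gcongr
  rw [Finset.card_univ]
  simp only [Fintype.card_sum, Fintype.card_bool, Fintype.card_fin]
  rw [← ENNReal.ofReal_natCast]
  refine ENNReal.ofReal_le_ofReal ?_
  have h3 := NeZero.pos dv
  -- The left side is the number of statistics.
  have h4 : 2 + dv + (dv + dμ) ≤ 4 * (dv + dμ) := by omega
  exact_mod_cast h4

end Statistics

/-! ### The regret bound -/

section Regret

variable {S : Type u} {A : Type v} [Fintype S] [Fintype A] {dv dμ : ℕ} {Cv γ : ℝ}

/-- The deviation of the gaps is controlled by the deviations of the statistics, uniformly in the
comparator. -/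
theorem deviation_gap_le [NeZero dv] [NeZero dμ] (M : MDP S A) (B : Basis S A dv dμ)
    (L : List (paramSet dv dμ Cv × Noise S A dμ)) {R : ℝ} (hR : 0 ≤ R)
    (hL : ∀ j, deviation (noiseKernel M B) L (stat γ M B j) ≤ R) (ϑ : paramSet dv dμ Cv) :
    deviation (noiseKernel M B) L (fun z => -((1 - γ) * gap (noiseGrad γ M B z) z.1 ϑ)) ≤
      (2 + Cv) * R := by
  have h1 : (fun z : paramSet dv dμ Cv × Noise S A dμ =>
      -((1 - γ) * gap (noiseGrad γ M B z) z.1 ϑ)) = fun z => pairStat γ M B z +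
        (∑ i, ϑ.1.1 i * ((1 - γ) * (noiseGrad γ M B z).1 i) +
        ∑ k, ϑ.1.2 k * ((1 - γ) * (noiseGrad γ M B z).2 k)) := by
    funext z
    have h2 : ∀ i, ϑ.1.1 i * ((1 - γ) * (noiseGrad γ M B z).1 i) =
      (1 - γ) * ((noiseGrad γ M B z).1 i * ϑ.1.1 i) := fun i => by ring
    have h3 : ∀ k, ϑ.1.2 k * ((1 - γ) * (noiseGrad γ M B z).2 k) =
      (1 - γ) * ((noiseGrad γ M B z).2 k * ϑ.1.2 k) := fun k => by ring
    simp only [gap, pairStat, h2, h3, mul_sub, Finset.sum_sub_distrib, ← Finset.mul_sum]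
    ring
  rw [h1, deviation_add, deviation_add, deviation_sum, deviation_sum]
  simp only [deviation_const_mul _ L (ϑ.1.1 _), deviation_const_mul _ L (ϑ.1.2 _)]
  have h2 : deviation (noiseKernel M B) L (pairStat γ M B) ≤ R := hL (.inl (.inl false))
  have h3 : ∀ i, |deviation (noiseKernel M B) L
      (fun z => (1 - γ) * (noiseGrad γ M B z).1 i)| ≤ R := fun i => by
    -- Coordinates of `ϑ_v` may have either sign, so both one-sided bounds are needed; for `ϑ_μ ≥ 0`
    -- below, one suffices.
    have h4 := hL (.inl (.inr i))
    have h5 := hL (.inr (.inl i))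
    simp only [stat, deviation_const_mul _ L 1, deviation_const_mul _ L (-1)] at h4 h5
    exact abs_le.2 ⟨by linarith, by linarith⟩
  have h4 := (le_abs_self _).trans (abs_sum_mul_le ϑ.2.1 hR h3)
  have h5 : ∑ k, ϑ.1.2 k * deviation (noiseKernel M B) L
      (fun z => (1 - γ) * (noiseGrad γ M B z).2 k) ≤ R := by
    calc _ ≤ ∑ k, ϑ.1.2 k * R := Finset.sum_le_sum fun k _ =>
          mul_le_mul_of_nonneg_left (hL (.inr (.inr k))) (ϑ.2.2.1 k)
      _ = R := by rw [← Finset.sum_mul, ϑ.2.2.2, one_mul]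
  simp only [mul_comm (deviation _ _ _) (ϑ.1.1 _)] at h4
  linarith

/-- The Euclidean part is bounded surely; the entropic part only through its mean plus a deviation,
since its sure bound would cost another factor `dμ`. -/
theorem sum_quadratic_le [NeZero dv] [NeZero dμ] (h0 : 0 ≤ γ) (h1 : γ < 1) (hCv : 0 < Cv)
    (M : MDP S A) (B : Basis S A dv dμ) (L : List (paramSet dv dμ Cv × Noise S A dμ)) {R : ℝ}
    (hL : deviation (noiseKernel M B) L (quadStat γ M B) ≤ R) :
    (1 - γ) ^ 2 * (L.map fun z => Cv ^ 2 / (2 * dv) * ∑ i, (noiseGrad γ M B z).1 i ^ 2 +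
        ∑ k, z.1.1.2 k * (noiseGrad γ M B z).2 k ^ 2).sum ≤
      L.length * (2 * Cv ^ 2) +
        dμ * (2 + 2 * Cv) * (R + L.length * (2 + 2 * Cv)) := by
  have hdv : (0 : ℝ) < dv := Nat.cast_pos.2 (NeZero.pos dv)
  have hd : (0 : ℝ) < dμ := zero_lt_one.trans_le one_le_cast
  have hp : 0 < dμ * (2 + 2 * Cv) := by positivity
  have h2 : ∀ z : paramSet dv dμ Cv × Noise S A dμ,
      (1 - γ) ^ 2 * (Cv ^ 2 / (2 * dv) * ∑ i, (noiseGrad γ M B z).1 i ^ 2 +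
        ∑ k, z.1.1.2 k * (noiseGrad γ M B z).2 k ^ 2) ≤
      2 * Cv ^ 2 + dμ * (2 + 2 * Cv) * quadStat γ M B z := fun z => by
    rw [quadStat, mul_div_cancel₀ _ hp.ne', mul_add]
    refine add_le_add ?_ (le_of_eq ?_)
    · have h3 : ∑ i, ((1 - γ) * (noiseGrad γ M B z).1 i) ^ 2 ≤ (dv : ℝ) * 4 := by
        calc _ ≤ ∑ _i : Fin dv, (4 : ℝ) := Finset.sum_le_sum fun i _ => by
              have := abs_le.1 (abs_noiseGrad_fst_le h0 h1 M B z i)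
              nlinarith
          _ = _ := by simp
      simp only [mul_pow, ← Finset.mul_sum] at h3
      calc _ = Cv ^ 2 / (2 * dv) * ((1 - γ) ^ 2 * ∑ i, (noiseGrad γ M B z).1 i ^ 2) := by ring
        _ ≤ Cv ^ 2 / (2 * dv) * (dv * 4) := by gcongr
        _ = 2 * Cv ^ 2 := by field_simp; norm_num
    · rw [Finset.mul_sum]
      exact Finset.sum_congr rfl fun k _ => by ring
  rw [← List.sum_map_mul_left]
  refine (List.sum_le_sum fun z _ => h2 z).trans ?_
  rw [List.sum_map_add, List.sum_map_mul_left _ (quadStat γ M B),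
    sum_eq_deviation_add (noiseKernel M B) L (quadStat γ M B)]
  have h3 := sum_map_le_length_mul L (fun z => expect_quadStat_le h0 h1 hCv M B z.1)
  have h4 : (L.map fun _ => 2 * Cv ^ 2).sum = L.length * (2 * Cv ^ 2) := by simp
  rw [h4]
  gcongr

/-- The residual of the average iterate, when all statistics deviate little from their means. -/
theorem mul_residual_average_le [NeZero dv] [NeZero dμ] (h0 : 0 ≤ γ) (h1 : γ < 1) (hCv : 0 < Cv)
    (M : MDP S A) (B : Basis S A dv dμ) {N : ℕ} (hN : 0 < N) {Λ : ℝ} (hΛ : dμ * Λ ≤ N)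
    (hbN : (2 + 2 * Cv) ^ 2 * dμ ≤ N) {θ : paramSet dv dμ Cv} (hθ : ∀ k, θ.1.2 k = 1 / dμ)
    {η : ℝ} (hη : η = (1 - γ) / Real.sqrt (N * (Cv ^ 2 + dμ))) {l : List (Noise S A dμ)}
    (hl : l.length = N - 1)
    (hdev : ∀ j, deviation (noiseKernel M B) (steps (noiseUpdate γ η M B) θ l) (stat γ M B j) ≤
      4 * (2 + 2 * Cv) * Real.sqrt (N * dμ * Λ)) (ϑ : paramSet dv dμ Cv) :
    N * ((1 - γ) * M.residual γ (B.average (iterates (noiseUpdate γ η M B) θ l)) (B.decode ϑ)) ≤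
      Real.sqrt (N * (Cv ^ 2 + dμ)) * (4 + Real.log dμ + 5 * (2 + 2 * Cv) ^ 2) +
        (2 + Cv) * (4 * (2 + 2 * Cv) * Real.sqrt (N * dμ * Λ)) + 2 * (2 + 2 * Cv) := by
  have hd : (1 : ℝ) ≤ dμ := one_le_cast
  have hN0 : (0 : ℝ) < N := Nat.cast_pos.2 hN
  have hγ : 0 < 1 - γ := by linarith
  have hb : 0 < 2 + 2 * Cv := by positivity
  set b := 2 + 2 * Cv with hb'
  set R := 4 * b * Real.sqrt (N * dμ * Λ) with hR
  set r := Real.sqrt (N * (Cv ^ 2 + dμ)) with hr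
  have hr2 : r ^ 2 = N * (Cv ^ 2 + dμ) := Real.sq_sqrt (by positivity)
  have hr0 : 0 < r := Real.sqrt_pos.2 (by positivity)
  have hη0 : 0 < η := by rw [hη]; positivity
  have hηr : η * r = 1 - γ := by rw [hη]; field_simp
  set L := steps (noiseUpdate γ η M B) θ l with hL
  have hLN : (L.length : ℝ) ≤ N := by
    rw [hL, length_steps, hl]
    exact_mod_cast Nat.sub_le N 1
  have hRN : R ≤ 4 * b * N := by
    refine mul_le_mul_of_nonneg_left (Real.sqrt_le_iff.2 ⟨hN0.le, ?_⟩) (by positivity)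
    nlinarith
  have hR0 : 0 ≤ R := by positivity
  have hθ0 : ∀ k, 0 < θ.1.2 k := fun k => by rw [hθ]; positivity
  have hg : ∀ (z : paramSet dv dμ Cv × Noise S A dμ) k, |η * (noiseGrad γ M B z).2 k| ≤ 1 := by
    intro z k
    have h2 := abs_noiseGrad_snd_le' h0 h1 hCv M B z k
    have h3 : η * (noiseGrad γ M B z).2 k = ((1 - γ) * (noiseGrad γ M B z).2 k) / r := by
      rw [hη]; ring
    -- `b² dμ ≤ N` gives `(dμ b)² ≤ N dμ ≤ r²`, so the losses `η g` meet the condition of the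
    -- exponential weights regret.
    have h4 : dμ * b ≤ r := by
      refine Real.le_sqrt_of_sq_le ?_
      nlinarith [sq_nonneg Cv]
    rw [h3, abs_div, abs_of_pos hr0, div_le_one hr0]
    exact h2.trans h4
  have hreg : (L.map fun z =>
      η * gap (noiseGrad γ M B z) z.1 ϑ - η ^ 2 * (Cv ^ 2 / (2 * dv) *
        ∑ i, (noiseGrad γ M B z).1 i ^ 2 + ∑ k, z.1.1.2 k * (noiseGrad γ M B z).2 k ^ 2)).sum ≤
      potential ϑ θ :=
    mul_sum_gap_le hCv hη0 (noiseGrad γ M B) hg ϑ l θ hθ0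
  have hsub : ∀ (f g : paramSet dv dμ Cv × Noise S A dμ → ℝ) (c e : ℝ),
      (L.map fun z => c * f z - e * g z).sum = c * (L.map f).sum - e * (L.map g).sum := by
    intro f g c e
    simp only [← List.sum_map_mul_left]
    induction L with
    | nil => simp
    | cons z L ih =>
      simp only [List.map_cons, List.sum_cons, ih]
      ring
  rw [hsub] at hreg
  have hquad := sum_quadratic_le h0 h1 hCv M B L (hdev (.inl (.inl true)))
  rw [← hb'] at hquad
  set G := (L.map fun z => gap (noiseGrad γ M B z) z.1 ϑ).sum with hG
  set Q := (L.map fun z => Cv ^ 2 / (2 * dv) *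
        ∑ i, (noiseGrad γ M B z).1 i ^ 2 + ∑ k, z.1.1.2 k * (noiseGrad γ M B z).2 k ^ 2).sum with hQ
  have hQ2 : η ^ 2 * Q ≤ 2 + 5 * b ^ 2 := by
    have h2 : η ^ 2 * Q = ((1 - γ) ^ 2 * Q) / r ^ 2 := by rw [← hηr]; field_simp
    rw [h2, div_le_iff₀ (by positivity), hr2]
    refine hquad.trans ?_
    calc _ ≤ N * (2 * Cv ^ 2) + dμ * b * (4 * b * N + N * b) := by gcongr
      _ ≤ (2 + 5 * b ^ 2) * (N * (Cv ^ 2 + dμ)) := by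
        have : 0 ≤ 5 * b ^ 2 * N * Cv ^ 2 + 2 * N * dμ := by positivity
        linarith
  have hpot := potential_le (ϑ := ϑ) hCv hθ
  have hG2 : (1 - γ) * G ≤ r * (4 + Real.log dμ + 5 * b ^ 2) := by
    rw [← hηr, mul_comm η r, mul_assoc]
    exact mul_le_mul_of_nonneg_left (by linarith) hr0.le
  have hdevG := deviation_gap_le M B L hR0 hdev ϑ
  -- Mean equals sample minus deviation: the residuals are the conditional means of the gaps.
  have hE : (L.map fun z => (1 - γ) * M.residual γ (B.decode z.1) (B.decode ϑ)).sum ≤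
      (1 - γ) * G + (2 + Cv) * R := by
    have h2 := sum_eq_deviation_add (noiseKernel M B) L
      (fun z => -((1 - γ) * gap (noiseGrad γ M B z) z.1 ϑ))
    simp only [expect_neg, expect_const_mul, expect_gap] at h2
    simp only [neg_mul_eq_neg_mul, List.sum_map_mul_left] at h2 hdevG ⊢
    linarith
  have hne : iterates (noiseUpdate γ η M B) θ l ≠ [] := by
    rw [iterates_eq]
    simp
  have hav := length_mul_residual_average (γ := γ) M B (B.decode ϑ) hne
  rw [length_iterates, hl, Nat.sub_add_cancel hN] at hav
  rw [mul_left_comm, hav, iterates_eq, List.map_append, List.sum_append, List.map_map]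
  -- There are `N` iterates but `N - 1` rounds of draws; the last iterate has no sampled gradient
  -- and is bounded crudely.
  have hlast := residual_decode_le h0 h1 M B (lastState (noiseUpdate γ η M B) θ l) ϑ
  rw [List.sum_map_mul_left] at hE
  simp only [List.map_cons, List.map_nil, List.sum_cons, List.sum_nil, add_zero, mul_add]
  change (1 - γ) * (L.map fun z => M.residual γ (B.decode z.1) (B.decode ϑ)).sum + _ ≤ _
  linarith

/-- The residual of an average of iterates is of order `1 / (1 - γ)`. -/
theorem residual_average_le [NeZero dv] (h0 : 0 ≤ γ) (h1 : γ < 1) (M : MDP S A)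
    (B : Basis S A dv dμ) {L : List (paramSet dv dμ Cv)} (hL : L ≠ []) (ϑ : paramSet dv dμ Cv) :
    (1 - γ) * M.residual γ (B.average L) (B.decode ϑ) ≤ 2 * (2 + 2 * Cv) := by
  have h2 := length_mul_residual_average (γ := γ) M B (B.decode ϑ) hL
  have h3 : (0 : ℝ) < L.length := Nat.cast_pos.2 (List.length_pos_iff.2 hL)
  refine le_of_mul_le_mul_left ?_ h3
  rw [mul_left_comm, h2, ← List.sum_map_mul_left]
  exact sum_map_le_length_mul L fun θ => residual_decode_le h0 h1 M B θ ϑ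

end Regret

/-! ### The sample complexity -/

section Numerics

/-- The constants of the regret bound, collected. -/
theorem regret_bound_le {Cv D L N d Λ : ℝ} (hCv : 0 < Cv) (hd : 1 ≤ d) (hdD : d ≤ D)
    (hL : 1 ≤ 2 * L) (hΛ : Λ ≤ 2 * (1 + Real.log D) * L) (hN : 1 ≤ N) :
    Real.sqrt (N * (Cv ^ 2 + d)) * (4 + Real.log d + 5 * (2 + 2 * Cv) ^ 2) +
        (2 + Cv) * (4 * (2 + 2 * Cv) * Real.sqrt (N * d * Λ)) + 2 * (2 + 2 * Cv) ≤
      9 * (2 + 2 * Cv) ^ 3 * Real.sqrt (N * (2 * D * (1 + Real.log D) ^ 2 * L)) := by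
  set b := 2 + 2 * Cv with hb
  have hb2 : 2 ≤ b := by linarith
  have hD : 1 ≤ D := hd.trans hdD
  have hlog : 0 ≤ Real.log D := Real.log_nonneg hD
  have hlogd : Real.log d ≤ Real.log D := Real.log_le_log (by linarith) hdD
  set q := 1 + Real.log D with hq
  have hq1 : 1 ≤ q := by linarith
  have hq2 : q ≤ q ^ 2 := by nlinarith
  set T := Real.sqrt (N * (2 * D * q ^ 2 * L)) with hT
  have hT1 : 1 ≤ T := by
    refine Real.one_le_sqrt.2 ?_
    have h2 : 1 ≤ D * q ^ 2 := one_le_mul_of_one_le_of_one_le hD (hq1.trans hq2)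
    have h3 : 1 ≤ D * q ^ 2 * (2 * L) := one_le_mul_of_one_le_of_one_le h2 hL
    calc 1 ≤ N * (D * q ^ 2 * (2 * L)) := one_le_mul_of_one_le_of_one_le hN h3
      _ = _ := by ring
  have hA : Real.sqrt (N * (Cv ^ 2 + d)) * q ≤ b * T := by
    rw [← Real.sqrt_sq (by linarith : 0 ≤ q), ← Real.sqrt_mul (by positivity),
      ← Real.sqrt_sq (by linarith : 0 ≤ b), hT, ← Real.sqrt_mul (by positivity)]
    refine Real.sqrt_le_sqrt ?_
    have h2 : Cv ^ 2 + d ≤ b ^ 2 * D := by nlinarith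
    calc N * (Cv ^ 2 + d) * q ^ 2 ≤ N * (b ^ 2 * D) * q ^ 2 * 1 := by rw [mul_one]; gcongr
      _ ≤ N * (b ^ 2 * D) * q ^ 2 * (2 * L) := by gcongr
      _ = _ := by ring
  have hB : Real.sqrt (N * d * Λ) ≤ T := by
    refine Real.sqrt_le_sqrt ?_
    have hL0 : 0 ≤ L := by linarith
    calc N * d * Λ ≤ N * d * (2 * q * L) := by gcongr
      _ ≤ N * D * (2 * q ^ 2 * L) := by gcongr
      _ = _ := by ring
  have hA2 : Real.sqrt (N * (Cv ^ 2 + d)) * (4 + Real.log d + 5 * b ^ 2) ≤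
      b * T * (4 + 5 * b ^ 2) := by
    calc _ ≤ Real.sqrt (N * (Cv ^ 2 + d)) * (q * (4 + 5 * b ^ 2)) := by
          gcongr
          nlinarith [sq_nonneg b]
      _ ≤ _ := by
          rw [← mul_assoc]
          gcongr
  have hB2 : (2 + Cv) * (4 * b * Real.sqrt (N * d * Λ)) ≤ b * (4 * b * T) := by
    gcongr
    linarith
  have hC2 : 2 * b ≤ 2 * b * T := le_mul_of_one_le_right (by linarith) hT1
  have hfin : b * (4 + 5 * b ^ 2) + b * (4 * b) + 2 * b ≤ 9 * b ^ 3 := by nlinarith [sq_nonneg b]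
  have := mul_le_mul_of_nonneg_right hfin (by linarith : 0 ≤ T)
  linarith

/-- Turns a sum of logarithms into the product of the stated rate, using `log (2 / δ) ≥ log 2 > 1 /
2`. -/
theorem log_four_mul_div_le {D δ : ℝ} (hD : 1 ≤ D) (hδ : 0 < δ) (hδ1 : δ < 1) :
    Real.log (4 * D / δ) ≤ 2 * (1 + Real.log D) * Real.log (2 / δ) := by
  have h1 : Real.log (4 * D / δ) = Real.log 2 + Real.log D + Real.log (2 / δ) := by
    rw [← Real.log_mul (by norm_num) (by positivity),
      ← Real.log_mul (by positivity) (by positivity)]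
    congr 1
    ring
  have h2 : Real.log 2 ≤ Real.log (2 / δ) :=
    Real.log_le_log (by norm_num) (by rw [le_div_iff₀ hδ]; linarith)
  have h3 := Real.log_two_gt_d9
  have h4 : 0 ≤ Real.log D := Real.log_nonneg hD
  rw [h1]
  nlinarith

end Numerics

end MirrorRL

end

/-! ### Choice of the number of rounds and proof of the theorem. -/

open MirrorRL in
theorem mainTheorem6 (Cv : ℝ) (hCv : 0 < Cv) :
    ∃ C : ℝ, 0 < C ∧
      ∀ (dv dμ : ℕ) [NeZero dv] [NeZero dμ] (γ ε δ : ℝ),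
        0 ≤ γ → γ < 1 → 0 < ε → 0 < δ → δ < 1 →
        ∃ N₀ : ℕ, 0 < N₀ ∧
          ∀ (S : Type u) (A : Type v) [Fintype S] [Fintype A] [Nonempty S] [Nonempty A]
            (B : Basis S A dv dμ) (θ₁ : paramSet dv dμ Cv),
            (∀ k, θ₁.1.2 k = 1 / dμ) →
            ∀ M : MDP S A,
              (∀ o ∈ ((mdForRL γ B N₀ θ₁).run M).support,
                (o.2 : ℝ) ≤ C * ((dv + dμ : ℕ) * (1 + Real.log (dv + dμ : ℕ)) ^ 2 *
                  Real.log (2 / δ) / ((1 - γ) ^ 2 * ε ^ 2))) ∧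
              ∀ N : ℕ, N₀ ≤ N → ∀ πstar : Policy S A, M.IsOptimal γ πstar →
                ENNReal.ofReal (1 - δ) ≤
                  ((mdForRL γ B N θ₁).run M).toOuterMeasure
                    {o | ∀ πhat : Policy S A, IsInducedBy πhat o.1.2 →
                      M.ret γ πstar - M.ret γ πhat ≤
                        ε + approxError M γ B Cv πstar πhat o.1} := by
  set b := 2 + 2 * Cv with hb
  have hb2 : 2 < b := by linarith
  refine ⟨486 * b ^ 6, by positivity, ?_⟩
  intro dv dμ _ _ γ ε δ h0 h1 hε hδ hδ1
  have hγ : 0 < 1 - γ := by linarith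
  have hdv : (1 : ℝ) ≤ dv := one_le_cast
  have hdμ : (1 : ℝ) ≤ dμ := one_le_cast
  have hDge : (dμ : ℝ) ≤ (dv + dμ : ℕ) := by push_cast; linarith
  set D : ℝ := ((dv + dμ : ℕ) : ℝ) with hD
  have hD1 : 1 ≤ D := hdμ.trans hDge
  set L := Real.log (2 / δ) with hL
  have hL1 : 1 ≤ 2 * L := by
    have h2 : Real.log 2 ≤ Real.log (2 / δ) :=
      Real.log_le_log (by norm_num) (by rw [le_div_iff₀ hδ]; linarith)
    have h3 := Real.log_two_gt_d9
    linarith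
  set q := 1 + Real.log D with hq
  have hq1 : 1 ≤ q := by linarith [Real.log_nonneg hD1]
  have hq2 : q ≤ q ^ 2 := by nlinarith
  -- The solution for `N` of `9 b³ √(N · 2 D q² L) = N (1 - γ) ε`, whence `162 = 2 · 9²`.
  set K := 162 * b ^ 6 * (D * q ^ 2 * L / ((1 - γ) ^ 2 * ε ^ 2)) with hK
  have hL0 : 0 < L := by linarith
  have hK0 : 0 ≤ K := by positivity
  -- With `N₀` iterates there are `N₀ - 1 = ⌊K⌋₊` updates of three samples each. The bound `3 K`
  -- thus holds even when `K < 1`, and `486 = 3 · 162`.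
  refine ⟨⌊K⌋₊ + 1, Nat.succ_pos _, ?_⟩
  intro S A _ _ _ _ B θ₁ hθ₁ M
  refine ⟨fun o ho => ?_, fun N hN πstar _ => ?_⟩
  · rw [run_mdForRL, PMF.mem_support_map_iff] at ho
    obtain ⟨l, -, rfl⟩ := ho
    have h2 := Nat.floor_le hK0
    simp only [Nat.add_sub_cancel]
    push_cast
    calc _ ≤ 3 * K := by linarith
      _ = _ := by rw [hK]; ring
  have hN0 : 0 < N := (Nat.succ_pos _).trans_le hN
  have hN1 : (1 : ℝ) ≤ N := Nat.one_le_cast.2 hN0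
  have hNK : K ≤ N := (Nat.lt_floor_add_one K).le.trans (by exact_mod_cast hN)
  have hgood : ∀ L' : List (paramSet dv dμ Cv),
      (∀ ϑ : paramSet dv dμ Cv, M.residual γ (B.average L') (B.decode ϑ) ≤ ε) →
      ∀ πhat : Policy S A, IsInducedBy πhat (B.average L').2 →
        M.ret γ πstar - M.ret γ πhat ≤ ε + approxError M γ B Cv πstar πhat (B.average L') := by
    intro L' h πhat hπ
    have : Nonempty (paramSet dv dμ Cv) := ⟨θ₁⟩
    rw [← sub_le_iff_le_add']
    refine le_ciInf fun ϑ => ?_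
    rw [M.residual_value_occupancy πstar h0 h1 πhat _ hπ]
    linarith [h ϑ]
  set η := (1 - γ) / Real.sqrt (N * (Cv ^ 2 + dμ)) with hη
  set ν := noiseLaw (noiseKernel M B) (noiseUpdate γ η M B) (N - 1) θ₁ with hν
  rw [run_mdForRL, PMF.toOuterMeasure_map_apply]
  -- For large `ε` the crude bound on the residual already suffices. Otherwise the upper bound on
  -- `(1 - γ) ε` forces `N` above the thresholds of the regret and Bernstein bounds.
  rcases le_total (2 * b) ((1 - γ) * ε) with hbig | hsmall
  · refine (ENNReal.ofReal_le_one.2 (by linarith)).trans (Eq.ge ?_)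
    rw [PMF.toOuterMeasure_apply_eq_one_iff]
    intro l _
    refine hgood _ fun ϑ => ?_
    refine le_of_mul_le_mul_left (le_trans ?_ hbig) hγ
    exact residual_average_le h0 h1 M B (by rw [iterates_eq]; simp) ϑ
  -- Chosen so that the union bound `4 D exp (-Λ)` equals `δ`.
  set Λ := Real.log (4 * D / δ) with hΛ
  have hΛle : Λ ≤ 2 * q * L := log_four_mul_div_le hD1 hδ hδ1
  have hΛ0 : 0 < Λ := Real.log_pos (by rw [lt_div_iff₀ hδ]; linarith)
  have hKge : b ^ 2 * (2 * D * q ^ 2 * L) ≤ N := by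
    refine le_trans ?_ hNK
    have h2 : ((1 - γ) * ε) ^ 2 ≤ (2 * b) ^ 2 := pow_le_pow_left₀ (by positivity) hsmall 2
    rw [hK, ← mul_div_assoc, le_div_iff₀ (by positivity)]
    calc _ = b ^ 2 * (2 * D * q ^ 2 * L) * ((1 - γ) * ε) ^ 2 := by ring
      _ ≤ b ^ 2 * (2 * D * q ^ 2 * L) * (2 * b) ^ 2 := by gcongr
      _ = 8 * b ^ 4 * (D * q ^ 2 * L) := by ring
      _ ≤ 162 * b ^ 6 * (D * q ^ 2 * L) := by
        gcongr
        · norm_num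
        · linarith
        · norm_num
  have hDq : D ≤ 2 * D * q ^ 2 * L := by
    have : 1 ≤ q ^ 2 * (2 * L) := one_le_mul_of_one_le_of_one_le (hq1.trans hq2) hL1
    nlinarith
  have hbN : b ^ 2 * dμ ≤ N := by
    refine le_trans ?_ hKge
    gcongr
    exact hDge.trans hDq
  have hΛN : dμ * Λ ≤ N := by
    refine le_trans ?_ hKge
    calc dμ * Λ ≤ D * (2 * q * L) := by gcongr
      _ ≤ D * (2 * q ^ 2 * L) := by gcongr
      _ = 1 * (2 * D * q ^ 2 * L) := by ring
      _ ≤ b ^ 2 * (2 * D * q ^ 2 * L) := by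
        gcongr
        nlinarith
  have hbad := noiseLaw_exists_deviation_le h0 h1 hCv M B (noiseUpdate γ η M B) hΛ0 hΛN (N - 1) θ₁
  have hexp : 4 * D * Real.exp (-Λ) = δ := by
    rw [hΛ, ← Real.log_inv, Real.exp_log (by positivity)]
    field_simp
  rw [← hD, hexp] at hbad
  rw [← hν] at hbad ⊢
  set G := (fun l => (B.average (iterates (noiseUpdate γ η M B) θ₁ l), 3 * (N - 1))) ⁻¹'
    {o : Decision S A × ℕ | ∀ πhat : Policy S A, IsInducedBy πhat o.1.2 →
      M.ret γ πstar - M.ret γ πhat ≤ ε + approxError M γ B Cv πstar πhat o.1} with hG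
  set bad := {l : List (Noise S A dμ) | l.length ≤ (N : ℝ) ∧
    ∃ j, 4 * (2 + 2 * Cv) * Real.sqrt (N * dμ * Λ) <
      deviation (noiseKernel M B) (steps (noiseUpdate γ η M B) θ₁ l) (stat γ M B j)} with hbad'
  -- On the support of `ν`, every list outside `bad` is in `G`; subadditivity then bounds the
  -- probability of `G` below without passing to complements.
  have hcover : ν.toOuterMeasure (G ∪ bad) = 1 := by
    rw [PMF.toOuterMeasure_apply_eq_one_iff]
    intro l hl
    have hlen := length_of_mem_support_noiseLaw _ _ hl
    by_cases hlb : l ∈ bad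
    · exact Or.inr hlb
    left
    have hdev : ∀ j, deviation (noiseKernel M B) (steps (noiseUpdate γ η M B) θ₁ l)
        (stat γ M B j) ≤ 4 * (2 + 2 * Cv) * Real.sqrt (N * dμ * Λ) := fun j => by
      by_contra hj
      refine hlb ⟨?_, j, not_le.1 hj⟩
      rw [hlen]
      exact_mod_cast Nat.sub_le N 1
    refine hgood _ fun ϑ => ?_
    have h2 := (mul_residual_average_le h0 h1 hCv M B hN0 hΛN hbN hθ₁ hη hlen hdev ϑ).trans
      (regret_bound_le hCv hdμ hDge hL1 hΛle hN1)
    have h3 : 9 * b ^ 3 * Real.sqrt (N * (2 * D * q ^ 2 * L)) ≤ N * ((1 - γ) * ε) := by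
      refine abs_le_of_sq_le_sq' ?_ (by positivity) |>.2
      rw [mul_pow, Real.sq_sqrt (by positivity)]
      have h4 : K * ((1 - γ) ^ 2 * ε ^ 2) = 162 * b ^ 6 * (D * q ^ 2 * L) := by
        rw [hK]
        field_simp
      calc _ = N * (K * ((1 - γ) ^ 2 * ε ^ 2)) := by rw [h4]; ring
        _ ≤ N * (N * ((1 - γ) ^ 2 * ε ^ 2)) := by gcongr
        _ = _ := by ring
    have h4 := le_of_mul_le_mul_left (h2.trans h3) (by linarith)
    exact le_of_mul_le_mul_left h4 hγ
  have h2 : 1 ≤ ν.toOuterMeasure G + ENNReal.ofReal δ := by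
    rw [← hcover]
    exact (MeasureTheory.measure_union_le _ _).trans (by gcongr)
  rw [ENNReal.ofReal_sub _ hδ.le, ENNReal.ofReal_one]
  exact tsub_le_iff_right.2 h2
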